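/- **Definitions.** Let $P,Q$ be two lattice paths from $(0,0)$ to $(m,r)$ with north and east unit steps, $P$ never going above $Q$, and put $n=m+r$. The bases of the matroid $M[P,Q]$ on $\{1,\dots,n\}$ are the sets of indices of the north steps of the lattice paths from $(0,0)$ to $(m,r)$ that stay between $P$ and $Q$. A *lattice path matroid* is a matroid isomorphic to some $M[P,Q]$. All oriented matroids have a finite ground set. An *orientation* of a matroid $M$ is an oriented matroid whose underlying matroid is $M$. A *coflow* of an oriented matroid $O$ with ground set $E$ is an element of the subgroup of $\mathbb{Z}^E$ generated by the $\{0,1,-1\}$-vectors of the signed cocircuits of $O$. A *nowhere-zero (NZ) $3$-coflow* is a coflow $x$ with $0<|x(e)|<3$ for every $e\in E$. $O$ is *generalized series parallel (GSP)* if every simple minor of $O$ with nonempty ground set has a nonzero $\{0,1,-1\}$-valued coflow with at most two nonzero entries. Two distinct elements $e,f$ of a matroid $M$ are *clones* in $M$ if the transposition of $e$ and $f$ is an automorphism of $M$. $M$ is *clone reducible* if every minor of $M$ with at least two elements, other than a two-element matroid consisting of a loop and a coloop, has a pair of clones. **Proposition.** Let $M$ be a lattice path matroid. 1. Every orientation of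 $M$ is a GSP oriented matroid. 2. If $M$ has no loops, then every orientation of $M$ has a NZ $3$-coflow. 3. If $M$ has at least two elements and is not a two-element matroid consisting of a loop and a coloop, then $M$ has a pair of clones. 4. $M$ is clone reducible. -/

import Mathlib

open scoped Finset

/-! ### Lattice path matroids -/

/-- A lattice path with `n` steps, starting at `(0, 0)` and using north steps `(0, 1)` and east
steps `(1, 0)`, is encoded by the set `S ⊆ Fin n` of the indices of its north steps.
`pathHeight S i` is the ordinate of the point reached after `i` steps (its abscissa is
`i - pathHeight S i`). -/
def pathHeight {n : ℕ} (S : Finset (Fin n)) (i : ℕ) : ℕ :=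
  #(S.filter (fun j : Fin n => (j : ℕ) < i))

/-- The path `S` never goes above the path `T`: on each antidiagonal the point of `S` is weakly
below (and hence weakly to the right of) the point of `T`. -/
def PathBelow {n : ℕ} (S T : Finset (Fin n)) : Prop :=
  ∀ i : ℕ, pathHeight S i ≤ pathHeight T i

/-- `S` is a lattice path with the same end point as `P` that stays in the region bounded by the
lower path `P` and the upper path `Q`. -/
def IsPathBetween {n : ℕ} (P Q S : Finset (Fin n)) : Prop :=
  #S = #P ∧ PathBelow P S ∧ PathBelow S Q

lemma pathHeight_zero {n : ℕ} (S : Finset (Fin n)) : pathHeight S 0 = 0 := by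
  simp [pathHeight]

lemma pathHeight_of_le {n : ℕ} (S : Finset (Fin n)) {i : ℕ} (hi : n ≤ i) :
    pathHeight S i = #S := by
  unfold pathHeight
  rw [Finset.filter_true_of_mem]
  intro j _
  exact lt_of_lt_of_le j.2 hi

lemma pathHeight_succ {n : ℕ} (S : Finset (Fin n)) (j : Fin n) :
    pathHeight S (j + 1) = pathHeight S j + if j ∈ S then 1 else 0 := by
  classical
  unfold pathHeight
  have h : S.filter (fun k : Fin n => (k : ℕ) < j + 1)
      = S.filter (fun k : Fin n => (k : ℕ) < j) ∪ (if j ∈ S then {j} else ∅) := by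
    ext k
    by_cases hj : j ∈ S
    · simp only [hj, if_true, Finset.mem_filter, Finset.mem_union, Finset.mem_singleton]
      constructor
      · rintro ⟨h1, h2⟩
        by_cases hk : k = j
        · exact Or.inr hk
        · have : (k : ℕ) ≠ j := fun h => hk (Fin.ext h)
          exact Or.inl ⟨h1, by omega⟩
      · rintro (⟨h1, h2⟩ | rfl)
        · exact ⟨h1, by omega⟩
        · exact ⟨hj, by omega⟩
    · simp only [hj, if_false, Finset.mem_filter, Finset.union_empty]
      constructor
      · rintro ⟨h1, h2⟩
        have : (k : ℕ) ≠ j := fun h => hj (Fin.ext h ▸ h1)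
        exact ⟨h1, by omega⟩
      · rintro ⟨h1, h2⟩
        exact ⟨h1, by omega⟩
  rw [h, Finset.card_union_of_disjoint]
  · split_ifs <;> simp
  · split_ifs <;> simp

lemma pathHeight_exchange {n : ℕ} (S : Finset (Fin n)) {x y : Fin n} (hx : x ∈ S) (hy : y ∉ S)
    (i : ℕ) :
    pathHeight (insert y (S.erase x)) i + (if (x : ℕ) < i then 1 else 0)
      = pathHeight S i + (if (y : ℕ) < i then 1 else 0) := by
  classical
  unfold pathHeight
  rw [Finset.filter_insert, Finset.filter_erase]
  have hy' : y ∉ (S.filter (fun j : Fin n => (j : ℕ) < i)).erase x := by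
    simp [hy]
  by_cases hxi : (x : ℕ) < i
  · have hxm : x ∈ S.filter (fun j : Fin n => (j : ℕ) < i) := by simp [hx, hxi]
    have := Finset.card_erase_add_one hxm
    split_ifs
    · rw [Finset.card_insert_of_notMem hy']
      omega
    · omega
  · have hxm : x ∉ S.filter (fun j : Fin n => (j : ℕ) < i) := by simp [hxi]
    rw [Finset.erase_eq_of_notMem hxm] at hy' ⊢
    split_ifs
    · rw [Finset.card_insert_of_notMem hy']
    · omega

/-- Basis exchange for the north step sets of the lattice paths between `P` and `Q`. -/
lemma IsPathBetween.exchange {n : ℕ} {P Q S T : Finset (Fin n)} (hS : IsPathBetween P Q S)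
    (hT : IsPathBetween P Q T) {x : Fin n} (hxS : x ∈ S) (hxT : x ∉ T) :
    ∃ y, y ∈ T ∧ y ∉ S ∧ IsPathBetween P Q (insert y (S.erase x)) := by
  classical
  obtain ⟨hSc, hPS, hSQ⟩ := hS
  obtain ⟨hTc, hPT, hTQ⟩ := hT
  have hcard : ∀ y, y ∉ S → #(insert y (S.erase x)) = #P := by
    intro y hy
    rw [Finset.card_insert_of_notMem (by simp [hy]), Finset.card_erase_add_one hxS, hSc]
  have hsx := pathHeight_succ S x
  have htx := pathHeight_succ T x
  simp only [hxS, hxT, if_true, if_false] at hsx htx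
  by_cases hc : pathHeight T (x + 1) < pathHeight S (x + 1)
  · -- swap `x` for a later element
    have hex : ∃ k : ℕ, (x : ℕ) < k ∧ pathHeight S (k + 1) ≤ pathHeight T (k + 1) := by
      refine ⟨n + x, by have := x.2; omega, ?_⟩
      rw [pathHeight_of_le S (by omega), pathHeight_of_le T (by omega)]
      omega
    obtain ⟨hk1, hk2⟩ := Nat.find_spec hex
    have hmin : ∀ m : ℕ, (x : ℕ) < m → m < Nat.find hex →
        pathHeight T (m + 1) < pathHeight S (m + 1) := by
      intro m h1 h2
      have := Nat.find_min hex h2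
      push Not at this
      exact this h1
    set k := Nat.find hex with hkdef
    have hlt : ∀ i : ℕ, (x : ℕ) < i → i ≤ k → pathHeight T i < pathHeight S i := by
      intro i h1 h2
      obtain ⟨m, rfl⟩ : ∃ m, i = m + 1 := ⟨i - 1, by omega⟩
      by_cases hm : m = x
      · rw [hm]; exact hc
      · exact hmin m (by omega) (by omega)
    have hkk := hlt k hk1 le_rfl
    have hkn : k < n := by
      by_contra h
      rw [pathHeight_of_le S (by omega), pathHeight_of_le T (by omega)] at hkk
      omega
    have hs := pathHeight_succ S ⟨k, hkn⟩
    have ht := pathHeight_succ T ⟨k, hkn⟩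
    simp only at hs ht
    have hyT : (⟨k, hkn⟩ : Fin n) ∈ T := by
      by_contra h
      simp only [h, if_false] at ht
      omega
    have hyS : (⟨k, hkn⟩ : Fin n) ∉ S := by
      intro h
      simp only [h, hyT, if_true] at hs ht
      omega
    refine ⟨⟨k, hkn⟩, hyT, hyS, hcard _ hyS, ?_, ?_⟩
    · intro i
      have he := pathHeight_exchange S hxS hyS i
      have h1 := hPS i
      have h2 := hPT i
      have h3 := hlt i
      simp only at he
      split_ifs at he <;> omega
    · intro i
      have he := pathHeight_exchange S hxS hyS i
      have h1 := hSQ i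
      simp only at he
      split_ifs at he <;> omega
  · -- swap `x` for an earlier element
    have hc' : pathHeight S x < pathHeight T x := by omega
    have hex : ∃ d : ℕ, d ≤ x ∧ pathHeight T (x - d) ≤ pathHeight S (x - d) :=
      ⟨x, le_rfl, by simp [pathHeight_zero]⟩
    obtain ⟨hd1, hd2⟩ := Nat.find_spec hex
    have hmin : ∀ m : ℕ, m < Nat.find hex →
        pathHeight S (x - m) < pathHeight T (x - m) := by
      intro m h2
      have := Nat.find_min hex h2
      push Not at this
      exact this (by omega)
    set d := Nat.find hex with hddef
    have hd0 : d ≠ 0 := by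
      intro h
      rw [h] at hd2
      simp only [Nat.sub_zero] at hd2
      omega
    have hlt : ∀ i : ℕ, x - d < i → i ≤ x → pathHeight S i < pathHeight T i := by
      intro i h1 h2
      have := hmin (x - i) (by omega)
      rwa [show (x : ℕ) - (x - i) = i by omega] at this
    have hkn : (x : ℕ) - d < n := by have := x.2; omega
    have hs := pathHeight_succ S ⟨x - d, hkn⟩
    have ht := pathHeight_succ T ⟨x - d, hkn⟩
    have hst := hlt (x - d + 1) (by omega) (by omega)
    simp only at hs ht
    have hyT : (⟨x - d, hkn⟩ : Fin n) ∈ T := by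
      by_contra h
      simp only [h, if_false] at ht
      omega
    have hyS : (⟨x - d, hkn⟩ : Fin n) ∉ S := by
      intro h
      simp only [h, hyT, if_true] at hs ht
      omega
    refine ⟨⟨x - d, hkn⟩, hyT, hyS, hcard _ hyS, ?_, ?_⟩
    · intro i
      have he := pathHeight_exchange S hxS hyS i
      have h1 := hPS i
      simp only at he
      split_ifs at he <;> omega
    · intro i
      have he := pathHeight_exchange S hxS hyS i
      have h1 := hSQ i
      have h2 := hTQ i
      have h3 := hlt i
      simp only at he
      split_ifs at he <;> omega

/-- The lattice path matroid `M[P, Q]` on `Fin n`, for two lattice paths `P`, `Q` with a common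
end point, `P` never going above `Q`: its bases are the north step sets of the lattice paths
with the same end point that stay between `P` and `Q`. -/
def latticePathMatroid {n : ℕ} (P Q : Finset (Fin n)) (_hcard : #P = #Q) (hPQ : PathBelow P Q) :
    Matroid (Fin n) :=
  Matroid.ofIsBaseOfFinite (E := Set.univ) Set.finite_univ
    (fun B => ∃ S : Finset (Fin n), (S : Set (Fin n)) = B ∧ IsPathBetween P Q S)
    ⟨P, P, rfl, rfl, fun _ => le_rfl, hPQ⟩
    (by
      classical
      rintro _ _ ⟨S, rfl, hS⟩ ⟨T, rfl, hT⟩ x ⟨hxS, hxT⟩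
      obtain ⟨y, hyT, hyS, h⟩ := hS.exchange hT (by simpa using hxS) (by simpa using hxT)
      exact ⟨y, ⟨by simpa using hyT, by simpa using hyS⟩, _, by simp, h⟩)
    (fun _ _ => Set.subset_univ _)

/-- A matroid is a lattice path matroid if it is isomorphic to some `M[P, Q]`. -/
def IsLatticePathMatroid {α : Type*} (M : Matroid α) : Prop :=
  ∃ (n : ℕ) (P Q : Finset (Fin n)) (hcard : #P = #Q) (hPQ : PathBelow P Q) (f : Fin n ↪ α),
    M = (latticePathMatroid P Q hcard hPQ).mapEmbedding f

/-! ### Clones -/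

open scoped Classical in
/-- `e` and `f` are (a pair of) clones in `M`: they are distinct elements of `M`, and the
transposition of `e` and `f` is an automorphism of `M`. -/
def AreClones {α : Type*} (M : Matroid α) (e f : α) : Prop :=
  e ∈ M.E ∧ f ∈ M.E ∧ e ≠ f ∧ M.mapEquiv (Equiv.swap e f) = M

/-- `M` consists of exactly two elements, one of them a loop and the other one a coloop. -/
def IsLoopPlusColoop {α : Type*} (M : Matroid α) : Prop :=
  ∃ e f, M.E = {e, f} ∧ M.IsLoop e ∧ M.IsColoop f

/-- `M` is clone reducible: each minor with at least two elements has a pair of clones. The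
two-element matroid formed by a loop and a coloop, which never has clones, is exempted. -/
def IsCloneReducible {α : Type*} (M : Matroid α) : Prop :=
  ∀ N : Matroid α, N.IsMinor M → N.E.Nontrivial → ¬ IsLoopPlusColoop N →
    ∃ e f, AreClones N e f

/-! ### Oriented matroids -/

/-- Sign vectors. The signed set `(X⁺, X⁻)` is the function with value `1` on `X⁺`, `-1` on `X⁻`
and `0` elsewhere. -/
abbrev SignVec (α : Type*) := α → SignType

/-- The nonzero members of `S` with inclusion-minimal support. -/
def minimalSupport {α : Type*} (S : Set (SignVec α)) : Set (SignVec α) :=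
  {X | X ∈ S ∧ X ≠ 0 ∧ ∀ Y ∈ S, Y ≠ 0 → Function.support Y ⊆ Function.support X →
    Function.support Y = Function.support X}

/-- Orthogonality of sign vectors: either the supports are disjoint, or there are an element
where the signs agree and an element where they are opposite. -/
def SignOrthogonal {α : Type*} (X Y : SignVec α) : Prop :=
  (∀ e, X e * Y e = 0) ∨ ((∃ e, X e * Y e = 1) ∧ ∃ e, X e * Y e = -1)

/-- A ground set with a collection of sign vectors. The circuit axioms of oriented matroids are
imposed by `SignedSystem.IsOrientedMatroid`. -/
structure SignedSystem (α : Type*) where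
  ground : Set α
  circuits : Set (SignVec α)

namespace SignedSystem

variable {α : Type*}

/-- The signed circuit axioms of an oriented matroid on a finite ground set. -/
structure IsOrientedMatroid (O : SignedSystem α) : Prop where
  finite : O.ground.Finite
  support_subset : ∀ X ∈ O.circuits, Function.support X ⊆ O.ground
  zero_notMem : (0 : SignVec α) ∉ O.circuits
  neg_mem : ∀ X ∈ O.circuits, -X ∈ O.circuits
  incomparable : ∀ X ∈ O.circuits, ∀ Y ∈ O.circuits,
    Function.support X ⊆ Function.support Y → X = Y ∨ X = -Y
  elimination : ∀ X ∈ O.circuits, ∀ Y ∈ O.circuits, X ≠ -Y → ∀ e, X e = 1 → Y e = -1 →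
    ∃ Z ∈ O.circuits, Z e = 0 ∧ (∀ g, Z g = 1 → X g = 1 ∨ Y g = 1) ∧
      ∀ g, Z g = -1 → X g = -1 ∨ Y g = -1

/-- `O` is an orientation of `M`: an oriented matroid with underlying matroid `M`, that is, the
supports of the signed circuits of `O` are the circuits of `M`. -/
def IsOrientationOf (O : SignedSystem α) (M : Matroid α) : Prop :=
  O.IsOrientedMatroid ∧ O.ground = M.E ∧
    ∀ C : Set α, M.IsCircuit C ↔ ∃ X ∈ O.circuits, Function.support X = C

/-- Deletion of the elements of `B`. -/
def delete (O : SignedSystem α) (B : Set α) : SignedSystem α where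
  ground := O.ground \ B
  circuits := {X ∈ O.circuits | Disjoint (Function.support X) B}

/-- Contraction of the elements of `A`: the signed circuits are the nonzero sign vectors of
minimal support among the restrictions of the signed circuits to the complement of `A`. -/
noncomputable def contract (O : SignedSystem α) (A : Set α) : SignedSystem α where
  ground := O.ground \ A
  circuits := minimalSupport ((fun X => Set.indicator Aᶜ X) '' O.circuits)

/-- The signed cocircuits, i.e. the signed circuits of the dual oriented matroid: the nonzero
sign vectors of minimal support among those on the ground set that are orthogonal to all signed
circuits. -/
def cocircuits (O : SignedSystem α) : Set (SignVec α) :=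
  minimalSupport {Y | Function.support Y ⊆ O.ground ∧ ∀ X ∈ O.circuits, SignOrthogonal X Y}

/-- The coflow lattice: the subgroup of `α → ℤ` generated by the signed vectors of the
cocircuits. Its elements are the coflows; they vanish outside of the ground set. -/
def coflowLattice (O : SignedSystem α) : AddSubgroup (α → ℤ) :=
  AddSubgroup.closure ((fun (Y : SignVec α) (e : α) => (Y e : ℤ)) '' O.cocircuits)

/-- There are no loops and no pairs of parallel elements: all circuits have at least three
elements. -/
def IsSimple (O : SignedSystem α) : Prop :=
  ∀ X ∈ O.circuits, 3 ≤ (Function.support X).encard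

/-- `O` is generalized series parallel: each simple minor (with nonempty ground set) has a
nonzero coflow with values in `{0, 1, -1}` and at most two nonzero entries. -/
def IsGSP (O : SignedSystem α) : Prop :=
  ∀ A B : Set α, ((O.contract A).delete B).ground.Nonempty →
    ((O.contract A).delete B).IsSimple →
    ∃ x ∈ ((O.contract A).delete B).coflowLattice,
      x ≠ 0 ∧ (∀ e, x e = 0 ∨ x e = 1 ∨ x e = -1) ∧ (Function.support x).encard ≤ 2

/-- `O` has a nowhere-zero `k`-coflow. -/
def HasNowhereZeroCoflow (O : SignedSystem α) (k : ℤ) : Prop :=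
  ∃ x ∈ O.coflowLattice, ∀ e ∈ O.ground, 0 < |x e| ∧ |x e| < k

end SignedSystem

/-! The combinatorial half replaces lattice path matroids by the class `IsHeightBounded`, where the
bounds are arbitrary functions. This class is closed under minors almost by inspection: contracting
an independent set shifts both bounds, and deleting a coindependent set keeps them. Clones come from
neighbours in the linear order. If everything before `x` is a loop or a coloop, all bases have the
same height at `x`, so when `x` is neither, exchanging `x` with its successor never violates a
bound. Hence a matroid without clones consists of loops and coloops, at most one of each
(`IsHeightBounded.exists_areClones`). Applied to minors, this gives clone reducibility.

The oriented half turns independent clones `e`, `f` into a coflow with values `±1` on `e`, `f` and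
zero elsewhere (`IsDualPair.exists_mem_signLattice_of_areClones`). Extend `{e, f}` to a base and let
`L` be the rest of it. The cocircuits avoiding `L` form a rank two configuration, in which the
clones have no parallel elements. With `e` placed at infinity, the other parallel classes are
linearly ordered, and an alternating sum of neighbouring cocircuits cancels everything except `e`
and one chosen class, here `{f}`. In a simple minor clones are independent, which is the GSP
property. A nowhere-zero 3-coflow follows by induction: discard parallel elements, then contract a
clone `e` and add plus or minus the coflow on `{e, f}` to a coflow of the contraction.

Orientations are given by circuits alone, so the argument also needs every cocircuit of the matroid
to carry a signature orthogonal to all signed circuits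
(`SignedSystem.IsOrientationOf.exists_signOrthogonal`). `IsDualPair` records just this
orthogonality, so the oriented matroid axioms need not be checked for minors. -/

/-! ### Matroids given by bounds on the heights of their bases -/

/-- The number of elements of `S` at a position before `t`. -/
noncomputable def heightAt {α : Type*} (pos : α → ℕ) (S : Set α) (t : ℕ) : ℕ :=
  (S ∩ {x | pos x < t}).ncard

/-- `M` has a finite ground set, and its bases are the sets all of whose heights, with respect to
some linear arrangement of the ground set, obey given lower and upper bounds. -/
def IsHeightBounded {α : Type*} (M : Matroid α) : Prop :=
  M.E.Finite ∧ ∃ pos : α → ℕ, Set.InjOn pos M.E ∧ ∃ lo hi : ℕ → ℤ,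
    ∀ B ⊆ M.E, M.IsBase B ↔ ∀ t, lo t ≤ heightAt pos B t ∧ (heightAt pos B t : ℤ) ≤ hi t

section HeightBounded

open scoped Matroid

variable {α : Type*} {M N : Matroid α} {pos : α → ℕ}

lemma heightAt_union {S T : Set α} (hS : S.Finite) (hT : T.Finite) (h : Disjoint S T) (t : ℕ) :
    heightAt pos (S ∪ T) t = heightAt pos S t + heightAt pos T t := by
  unfold heightAt
  rw [Set.union_inter_distrib_right, Set.ncard_union_eq
    (h.mono Set.inter_subset_left Set.inter_subset_left)
    (hS.inter_of_left _) (hT.inter_of_left _)]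

lemma heightAt_singleton (x : α) (t : ℕ) :
    heightAt pos {x} t = if pos x < t then 1 else 0 := by
  unfold heightAt
  split_ifs with h
  · rw [Set.inter_eq_left.2 (by simpa using h), Set.ncard_singleton]
  · rw [Set.disjoint_iff_inter_eq_empty.1 (by simpa using h), Set.ncard_empty]

lemma heightAt_insert {S : Set α} (hS : S.Finite) {x : α} (hx : x ∉ S) (t : ℕ) :
    heightAt pos (insert x S) t = heightAt pos S t + if pos x < t then 1 else 0 := by
  rw [← Set.union_singleton, heightAt_union hS (Set.finite_singleton x) (by simpa using hx),
    heightAt_singleton]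

lemma heightAt_sdiff_singleton {S : Set α} (hS : S.Finite) {x : α} (hx : x ∈ S) (t : ℕ) :
    heightAt pos (S \ {x}) t + (if pos x < t then 1 else 0) = heightAt pos S t := by
  rw [← heightAt_insert (hS.subset Set.sdiff_subset) (by simp), Set.insert_sdiff_self_of_mem hx]

lemma heightAt_exchange {S : Set α} (hS : S.Finite) {x y : α} (hx : x ∈ S) (hy : y ∉ S) (t : ℕ) :
    heightAt pos (insert y (S \ {x})) t + (if pos x < t then 1 else 0)
      = heightAt pos S t + if pos y < t then 1 else 0 := by
  rw [heightAt_insert (hS.subset Set.sdiff_subset) (by simp [hy]),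
    ← heightAt_sdiff_singleton hS hx t]
  omega

/-! ### Closure under minors -/

lemma IsHeightBounded.contract_indep (h : IsHeightBounded M) {I : Set α} (hI : M.Indep I) :
    IsHeightBounded (M ／ I) := by
  obtain ⟨hfin, pos, hpos, lo, hi, hB⟩ := h
  refine ⟨hfin.subset Set.sdiff_subset, pos, hpos.mono Set.sdiff_subset,
    fun t => lo t - heightAt pos I t, fun t => hi t - heightAt pos I t, fun B hBE => ?_⟩
  have hdj : Disjoint B I := (Set.subset_sdiff.1 hBE).2
  have hBE' : B ⊆ M.E := (Set.subset_sdiff.1 hBE).1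
  rw [hI.contract_isBase_iff, and_iff_left hdj, hB _ (Set.union_subset hBE' hI.subset_ground)]
  refine forall_congr' fun t => ?_
  rw [heightAt_union (hfin.subset hBE') (hfin.subset hI.subset_ground) hdj]
  push_cast
  constructor <;> rintro ⟨h1, h2⟩ <;> constructor <;> linarith

lemma IsHeightBounded.delete_coindep (h : IsHeightBounded M) {D : Set α} (hD : M.Coindep D) :
    IsHeightBounded (M ＼ D) := by
  obtain ⟨hfin, pos, hpos, lo, hi, hB⟩ := h
  refine ⟨hfin.subset Set.sdiff_subset, pos, hpos.mono Set.sdiff_subset, lo, hi, fun B hBE => ?_⟩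
  rw [hD.delete_isBase_iff, and_iff_left (Set.subset_sdiff.1 hBE).2, hB _ (Set.subset_sdiff.1 hBE).1]

/-- After deleting a maximal coindependent subset `J` of `D`, the remaining elements of `D` are
coloops. Deleting coloops is the same as contracting them, and they form an independent set. -/
lemma IsHeightBounded.delete (h : IsHeightBounded M) (D : Set α) : IsHeightBounded (M ＼ D) := by
  obtain ⟨J, hJ⟩ := M✶.exists_isBasis' D
  have hco : M.Coindep J := hJ.indep
  have h1 : M ＼ D = M ＼ J ／ (D \ J) := by
    rw [← Matroid.dual_contract_dual, hJ.contract_eq_contract_delete, Matroid.dual_delete,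
      Matroid.dual_contract, Matroid.dual_dual]
  rw [h1]
  have hcol : (D \ J) ∩ (M ＼ J).E ⊆ (M ＼ J).coloops := by
    intro x hx
    have hcl : x ∈ M✶.closure J := by
      rw [hJ.closure_eq_closure]
      exact M✶.mem_closure_of_mem' hx.1.1 hx.2.1
    have : (M✶ ／ J).IsLoop x := Matroid.contract_isLoop_iff_mem_closure.2 ⟨hcl, hx.1.2⟩
    rw [← Matroid.dual_delete] at this
    exact this
  -- `D` may stick out of the ground set; only the part inside consists of coloops.
  rw [← Matroid.contract_inter_ground_eq]
  exact (h.delete_coindep hco).contract_indep ((Matroid.coloops_indep _).subset hcol)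

lemma IsHeightBounded.contract (h : IsHeightBounded M) (C : Set α) : IsHeightBounded (M ／ C) := by
  obtain ⟨I, hI⟩ := M.exists_isBasis' C
  rw [hI.contract_eq_contract_delete]
  exact (h.contract_indep hI.indep).delete _

lemma IsHeightBounded.isMinor (h : IsHeightBounded M) (hN : N.IsMinor M) : IsHeightBounded N := by
  obtain ⟨C, D, rfl⟩ := hN
  exact (h.contract C).delete D

/-! ### Clones -/

lemma areClones_of_exchange {e f : α} (he : e ∈ M.E) (hf : f ∈ M.E) (hne : e ≠ f)
    (h1 : ∀ B, M.IsBase B → e ∈ B → f ∉ B → M.IsBase (insert f (B \ {e})))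
    (h2 : ∀ B, M.IsBase B → f ∈ B → e ∉ B → M.IsBase (insert e (B \ {f}))) :
    AreClones M e f := by
  classical
  have hswap : ∀ B, M.IsBase B → M.IsBase (Equiv.swap e f '' B) := by
    intro B hB
    by_cases heB : e ∈ B <;> by_cases hfB : f ∈ B
    · convert hB using 1
      ext x
      rw [Equiv.image_eq_preimage_symm, Equiv.symm_swap, Set.mem_preimage, Equiv.swap_apply_def]
      grind
    · convert h1 B hB heB hfB using 1
      ext x
      rw [Equiv.image_eq_preimage_symm, Equiv.symm_swap, Set.mem_preimage, Equiv.swap_apply_def]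
      grind
    · convert h2 B hB hfB heB using 1
      ext x
      rw [Equiv.image_eq_preimage_symm, Equiv.symm_swap, Set.mem_preimage, Equiv.swap_apply_def]
      grind
    · convert hB using 1
      ext x
      rw [Equiv.image_eq_preimage_symm, Equiv.symm_swap, Set.mem_preimage, Equiv.swap_apply_def]
      grind
  refine ⟨he, hf, hne, ?_⟩
  have key : ∀ s : α ≃ α, s = Equiv.swap e f → M.mapEquiv s = M := by
    rintro s rfl
    refine Matroid.ext_isBase ?_ fun B _ => ?_
    · rw [Matroid.mapEquiv_ground_eq]
      ext x
      rw [Equiv.image_eq_preimage_symm, Equiv.symm_swap, Set.mem_preimage, Equiv.swap_apply_def]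
      grind
    · rw [Matroid.mapEquiv_isBase_iff, Equiv.symm_swap]
      refine ⟨fun h => ?_, hswap B⟩
      have := hswap _ h
      rwa [← Set.image_comp, ← Equiv.coe_trans, Equiv.swap_swap, Equiv.coe_refl,
        Set.image_id] at this
  exact key _ (by congr!)

lemma AreClones.isBase_exchange {e f : α} (h : AreClones M e f) {B : Set α} (hB : M.IsBase B)
    (he : e ∈ B) (hf : f ∉ B) : M.IsBase (insert f (B \ {e})) := by
  classical
  have h2 := h.2.2.2
  rw [← h2, Matroid.mapEquiv_isBase_iff, Equiv.symm_swap]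
  convert hB using 1
  ext x
  rw [Equiv.image_eq_preimage_symm, Equiv.symm_swap, Set.mem_preimage, Equiv.swap_apply_def]
  grind

lemma AreClones.symm {e f : α} (h : AreClones M e f) : AreClones M f e := by
  classical
  exact ⟨h.2.1, h.1, h.2.2.1.symm, by rw [Equiv.swap_comm]; exact h.2.2.2⟩

lemma areClones_of_isLoop {e f : α} (he : M.IsLoop e) (hf : M.IsLoop f) (hne : e ≠ f) :
    AreClones M e f :=
  areClones_of_exchange he.mem_ground hf.mem_ground hne
    (fun B hB h _ => absurd h (Matroid.isLoop_iff_forall_mem_compl_isBase.1 he B hB).2)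
    (fun B hB h _ => absurd h (Matroid.isLoop_iff_forall_mem_compl_isBase.1 hf B hB).2)

lemma areClones_of_isColoop {e f : α} (he : M.IsColoop e) (hf : M.IsColoop f) (hne : e ≠ f) :
    AreClones M e f :=
  areClones_of_exchange he.mem_ground hf.mem_ground hne
    (fun _ hB _ h => absurd (hf.mem_of_isBase hB) h)
    (fun _ hB _ h => absurd (he.mem_of_isBase hB) h)

/-- If `x` and its successor `y` are not clones and all elements before `x` are loops or coloops,
then so is `x`. -/
lemma isLoop_or_isColoop_of_forall_before {lo hi : ℕ → ℤ} (hfin : M.E.Finite)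
    (hinj : Set.InjOn pos M.E)
    (hbase : ∀ B ⊆ M.E, M.IsBase B ↔
      ∀ t, lo t ≤ heightAt pos B t ∧ (heightAt pos B t : ℤ) ≤ hi t)
    {x y : α} (hx : x ∈ M.E) (hy : y ∈ M.E) (hxy : pos x < pos y)
    (hsucc : ∀ z ∈ M.E, pos x < pos z → pos y ≤ pos z)
    (hbefore : ∀ z ∈ M.E, pos z < pos x → M.IsLoop z ∨ M.IsColoop z)
    (hclones : ¬ AreClones M x y) : M.IsLoop x ∨ M.IsColoop x := by
  have hne : x ≠ y := by rintro rfl; omega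
  have hb : ∀ B, M.IsBase B ↔ B ⊆ M.E ∧
      ∀ t, lo t ≤ heightAt pos B t ∧ (heightAt pos B t : ℤ) ≤ hi t :=
    fun B => ⟨fun h => ⟨h.subset_ground, (hbase B h.subset_ground).1 h⟩,
      fun h => (hbase B h.1).2 h.2⟩
  -- Loops lie in no base and coloops in all of them, so any two bases coincide before `x`.
  have hbefore' : ∀ S T, M.IsBase S → M.IsBase T →
      heightAt pos S (pos x) = heightAt pos T (pos x) := by
    intro S T hS hT
    unfold heightAt
    congr 1
    ext z
    simp only [Set.mem_inter_iff, Set.mem_ofPred_eq, and_congr_left_iff]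
    intro hz
    have key : ∀ S T, M.IsBase S → M.IsBase T → z ∈ S → z ∈ T := by
      intro S T hS hT hzS
      rcases hbefore z (hS.subset_ground hzS) hz with h | h
      · exact absurd hzS (Matroid.isLoop_iff_forall_mem_compl_isBase.1 h S hS).2
      · exact h.mem_of_isBase hT
    exact ⟨key S T hS hT, key T S hT hS⟩
  -- No element lies strictly between `x` and `y`, so in this range only the membership of `x`
  -- matters.
  have hheight : ∀ S t, M.IsBase S → pos x < t → t ≤ pos y → ∀ n, heightAt pos S t = n →
      (x ∈ S → n = heightAt pos S (pos x) + 1) ∧ (x ∉ S → n = heightAt pos S (pos x)) := by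
    rintro S t hS h1 h2 _ rfl
    have hz : ∀ z ∈ S, pos z < t → z ≠ x → pos z < pos x := by
      intro z hz hzt hzx
      by_contra hcon
      have : pos z ≠ pos x := fun h => hzx (hinj (hS.subset_ground hz) hx h)
      have := hsucc z (hS.subset_ground hz) (by omega)
      omega
    constructor
    · intro hxS
      unfold heightAt
      rw [← Set.ncard_insert_of_notMem (a := x) (by simp)
        ((hfin.subset hS.subset_ground).inter_of_left _)]
      congr 1
      ext z
      simp only [Set.mem_inter_iff, Set.mem_ofPred_eq, Set.mem_insert_iff]
      constructor
      · rintro ⟨h3, h4⟩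
        by_cases h5 : z = x
        · exact Or.inl h5
        · exact Or.inr ⟨h3, hz z h3 h4 h5⟩
      · rintro (rfl | ⟨h3, h4⟩)
        · exact ⟨hxS, h1⟩
        · exact ⟨h3, by omega⟩
    · intro hxS
      unfold heightAt
      congr 1
      ext z
      simp only [Set.mem_inter_iff, Set.mem_ofPred_eq, and_congr_right_iff]
      intro h3
      exact ⟨fun h4 => hz z h3 h4 (by rintro rfl; exact hxS h3), fun h4 => by omega⟩
  by_contra hcon
  push Not at hcon
  obtain ⟨hnl, hnc⟩ := hcon
  rw [Matroid.isLoop_iff_forall_notMem_isBase hx] at hnl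
  rw [Matroid.isColoop_iff_forall_mem_isBase] at hnc
  push Not at hnl hnc
  obtain ⟨S, hS, hxS⟩ := hnl
  obtain ⟨T, hT, hxT⟩ := hnc
  have hS' := (hb S).1 hS
  have hT' := (hb T).1 hT
  refine hclones (areClones_of_exchange hx hy hne ?_ ?_)
  · intro B hB hxB hyB
    obtain ⟨hBE, hBt⟩ := (hb B).1 hB
    refine (hb _).2 ⟨Set.insert_subset hy (Set.sdiff_subset.trans hBE), fun t => ?_⟩
    have hex := heightAt_exchange (pos := pos) (hfin.subset hBE) hxB hyB t
    -- The exchange lowers the height by one exactly for `pos x < t ≤ pos y`. The new height there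
    -- is that of the base `T`, which avoids `x`, so the lower bound still holds. The reverse
    -- exchange is compared with `S` in the same way.
    have hBt' := hBt t
    by_cases ht : pos x < t ∧ t ≤ pos y
    · have h1 := (hheight B t hB ht.1 ht.2 _ rfl).1 hxB
      have h2 := (hheight T t hT ht.1 ht.2 _ rfl).2 hxT
      have h3 := hbefore' B T hB hT
      have h4 := hT'.2 t
      rw [if_pos ht.1, if_neg (by omega)] at hex
      constructor <;> omega
    · split_ifs at hex <;> constructor <;> omega
  · intro B hB hyB hxB
    obtain ⟨hBE, hBt⟩ := (hb B).1 hB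
    refine (hb _).2 ⟨Set.insert_subset hx (Set.sdiff_subset.trans hBE), fun t => ?_⟩
    have hex := heightAt_exchange (pos := pos) (hfin.subset hBE) hyB hxB t
    have hBt' := hBt t
    by_cases ht : pos x < t ∧ t ≤ pos y
    · have h1 := (hheight B t hB ht.1 ht.2 _ rfl).2 hxB
      have h2 := (hheight S t hS ht.1 ht.2 _ rfl).1 hxS
      have h3 := hbefore' B S hB hS
      have h4 := hS'.2 t
      rw [if_pos ht.1, if_neg (by omega)] at hex
      constructor <;> omega
    · split_ifs at hex <;> constructor <;> omega

/-- If all elements but one are loops or coloops, then so is the last one. -/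
lemma isLoop_or_isColoop_of_forall_ne {x : α} (hx : x ∈ M.E)
    (h : ∀ z ∈ M.E, z ≠ x → M.IsLoop z ∨ M.IsColoop z) : M.IsLoop x ∨ M.IsColoop x := by
  by_contra hcon
  push Not at hcon
  obtain ⟨hnl, hnc⟩ := hcon
  rw [Matroid.isLoop_iff_forall_notMem_isBase hx] at hnl
  rw [Matroid.isColoop_iff_forall_mem_isBase] at hnc
  push Not at hnl hnc
  obtain ⟨S, hS, hxS⟩ := hnl
  obtain ⟨T, hT, hxT⟩ := hnc
  have hTS : T ⊆ S := by
    intro z hz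
    rcases h z (hT.subset_ground hz) (by rintro rfl; exact hxT hz) with h | h
    · exact absurd hz (Matroid.isLoop_iff_forall_mem_compl_isBase.1 h T hT).2
    · exact h.mem_of_isBase hS
  exact hxT (hT.eq_of_subset_isBase hS hTS ▸ hxS)

/-- Without clones, induction along the order shows that each element having a successor is a loop
or a coloop, and then the last one is too. Two loops, or two coloops, would be clones, so only the
excluded matroid is left. -/
theorem IsHeightBounded.exists_areClones (h : IsHeightBounded M) (hnt : M.E.Nontrivial)
    (hlc : ¬ IsLoopPlusColoop M) : ∃ e f, AreClones M e f := by
  obtain ⟨hfin, pos, hinj, lo, hi, hbase⟩ := h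
  by_contra hno
  push Not at hno
  have hstep : ∀ n, ∀ x ∈ M.E, pos x = n → (∃ y ∈ M.E, pos x < pos y) →
      M.IsLoop x ∨ M.IsColoop x := by
    intro n
    induction n using Nat.strong_induction_on with
    | _ n ih =>
      rintro x hx rfl hex
      obtain ⟨y, ⟨hyE, hxy⟩, hmin⟩ := Set.exists_min_image {y | y ∈ M.E ∧ pos x < pos y} pos
        (hfin.subset fun z hz => hz.1) hex
      exact isLoop_or_isColoop_of_forall_before hfin hinj hbase hx hyE hxy
        (fun z hz hxz => hmin z ⟨hz, hxz⟩)
        (fun z hz hzx => ih _ hzx z hz rfl ⟨x, hx, hzx⟩) (hno x y)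
  have hall : ∀ x ∈ M.E, M.IsLoop x ∨ M.IsColoop x := by
    intro x hx
    by_cases hex : ∃ y ∈ M.E, pos x < pos y
    · exact hstep _ x hx rfl hex
    · push Not at hex
      refine isLoop_or_isColoop_of_forall_ne hx fun z hz hne => ?_
      refine hstep _ z hz rfl ⟨x, hx, lt_of_le_of_ne (hex z hz) fun h => hne (hinj hz hx h)⟩
  have hloop : ∀ x y, M.IsLoop x → M.IsLoop y → x = y := fun x y hx hy => by
    by_contra hne
    exact hno x y (areClones_of_isLoop hx hy hne)
  have hcoloop : ∀ x y, M.IsColoop x → M.IsColoop y → x = y := fun x y hx hy => by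
    by_contra hne
    exact hno x y (areClones_of_isColoop hx hy hne)
  have hpair : ∀ e f, M.IsLoop e → M.IsColoop f → False := by
    intro e f he hf
    refine hlc ⟨e, f, Set.Subset.antisymm (fun z hz => ?_) ?_, he, hf⟩
    · rcases hall z hz with h | h
      · exact Or.inl (hloop _ _ h he)
      · exact Or.inr (hcoloop _ _ h hf)
    · rintro z (rfl | rfl)
      exacts [he.mem_ground, hf.mem_ground]
  obtain ⟨x, hx, y, hy, hne⟩ := hnt
  rcases hall x hx with hx' | hx' <;> rcases hall y hy with hy' | hy'
  · exact hne (hloop _ _ hx' hy')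
  · exact hpair _ _ hx' hy'
  · exact hpair _ _ hy' hx'
  · exact hne (hcoloop _ _ hx' hy')

theorem IsHeightBounded.isCloneReducible (h : IsHeightBounded M) : IsCloneReducible M :=
  fun _ hN hnt hlc => (h.isMinor hN).exists_areClones hnt hlc

/-! ### Lattice path matroids are height bounded -/

lemma heightAt_fin {n : ℕ} (f : Fin n ↪ α) (hpos : ∀ i, pos (f i) = i) (S : Finset (Fin n))
    (t : ℕ) : heightAt pos (f '' S) t = pathHeight S t := by
  unfold heightAt pathHeight
  rw [← Set.ncard_coe_finset, ← Set.ncard_image_of_injective _ f.injective]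
  congr 1
  ext x
  simp only [Set.mem_inter_iff, Set.mem_image, Set.mem_ofPred_eq, Finset.coe_filter,
    Finset.mem_coe]
  constructor
  · rintro ⟨⟨i, hi, rfl⟩, h⟩
    exact ⟨i, ⟨hi, by rwa [hpos] at h⟩, rfl⟩
  · rintro ⟨i, ⟨hi, h⟩, rfl⟩
    exact ⟨⟨i, hi, rfl⟩, by rwa [hpos]⟩

lemma latticePathMatroid_isBase_iff {n : ℕ} {P Q : Finset (Fin n)} {hcard : #P = #Q}
    {hPQ : PathBelow P Q} {S : Finset (Fin n)} :
    (latticePathMatroid P Q hcard hPQ).IsBase S ↔ IsPathBetween P Q S := by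
  change (∃ T : Finset (Fin n), (T : Set (Fin n)) = S ∧ IsPathBetween P Q T) ↔ _
  simp

lemma IsLatticePathMatroid.isHeightBounded (h : IsLatticePathMatroid M) : IsHeightBounded M := by
  classical
  obtain ⟨n, P, Q, hcard, hPQ, f, rfl⟩ := h
  have hE : ((latticePathMatroid P Q hcard hPQ).mapEmbedding f).E = Set.range f := by
    rw [Matroid.mapEmbedding_ground_eq]
    exact Set.image_univ
  obtain ⟨pos, hpos⟩ : ∃ pos : α → ℕ, ∀ i, pos (f i) = i :=
    ⟨Function.extend f (fun i => (i : ℕ)) 0, fun i => f.injective.extend_apply _ _ i⟩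
  refine ⟨hE ▸ Set.finite_range f, pos, ?_, fun t => pathHeight P t, fun t => pathHeight Q t,
    fun B hB => ?_⟩
  · rw [hE]
    rintro _ ⟨i, rfl⟩ _ ⟨j, rfl⟩ hij
    rw [hpos, hpos] at hij
    rw [Fin.ext hij]
  rw [hE] at hB
  rw [Matroid.mapEmbedding_isBase_iff, and_iff_left hB]
  obtain ⟨S, rfl⟩ : ∃ S : Finset (Fin n), B = f '' S :=
    ⟨(f ⁻¹' B).toFinset, by rw [Set.coe_toFinset, Set.image_preimage_eq_of_subset hB]⟩
  rw [Set.preimage_image_eq _ f.injective, latticePathMatroid_isBase_iff]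
  simp only [heightAt_fin f hpos, Nat.cast_le]
  constructor
  · rintro ⟨-, h1, h2⟩ t
    exact ⟨h1 t, h2 t⟩
  · intro h
    refine ⟨?_, fun t => (h t).1, fun t => (h t).2⟩
    -- At `n` both bounds equal the common size of `P` and `Q`, which forces the size of `S`.
    have := h n
    rw [pathHeight_of_le _ le_rfl, pathHeight_of_le _ le_rfl, pathHeight_of_le _ le_rfl] at this
    omega

end HeightBounded

/-! ### Signed cocircuits of an oriented matroid -/

section SignedCocircuits

variable {α : Type*} {M : Matroid α} {O : SignedSystem α}

lemma SignVec.support_neg (X : SignVec α) : Function.support (-X) = Function.support X := by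
  ext g
  have hsign : ∀ x : SignType, -x ≠ 0 ↔ x ≠ 0 := by decide
  exact hsign _

/-- The case `e = f` is allowed: the conclusion is then absurd, so orthogonal supports never meet in
a single element. -/
lemma SignOrthogonal.eq_neg_of_inter {X Y : SignVec α} (h : SignOrthogonal X Y) {e f : α}
    (he : X e * Y e ≠ 0) (hoff : ∀ g, g ≠ e → g ≠ f → X g * Y g = 0) :
    X e * Y e = -(X f * Y f) := by
  rcases h with h | ⟨⟨a, ha⟩, b, hb⟩
  · exact absurd (h e) he
  have ha' : a = e ∨ a = f := by
    by_contra hcon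
    push Not at hcon
    rw [hoff a hcon.1 hcon.2] at ha
    exact absurd ha (by decide)
  have hb' : b = e ∨ b = f := by
    by_contra hcon
    push Not at hcon
    rw [hoff b hcon.1 hcon.2] at hb
    exact absurd hb (by decide)
  rcases ha' with rfl | rfl <;> rcases hb' with rfl | rfl
  · rw [ha] at hb; exact absurd hb (by decide)
  · rw [ha, hb]; decide
  · rw [ha, hb]
  · rw [ha] at hb; exact absurd hb (by decide)

/-- Sign-symmetric form of the elimination axiom: every nonzero entry of `Z` is copied from `X` or
from `Y`. -/
lemma SignedSystem.IsOrientedMatroid.exists_elimination (hO : O.IsOrientedMatroid)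
    {X Y : SignVec α} (hX : X ∈ O.circuits) (hY : Y ∈ O.circuits) (hne : X ≠ -Y) {e : α}
    (he : X e ≠ 0) (hXY : X e = -Y e) :
    ∃ Z ∈ O.circuits, Z e = 0 ∧ ∀ g, Z g ≠ 0 → Z g = X g ∨ Z g = Y g := by
  have key : ∀ a : SignType, a ≠ 0 → a = 1 ∨ a = -1 := by decide
  rcases key _ he with h | h
  · have hYe : Y e = -1 := by rw [← neg_neg (Y e), ← hXY, h]
    obtain ⟨Z, hZ, hZe, hp, hn⟩ := hO.elimination X hX Y hY hne e h hYe
    refine ⟨Z, hZ, hZe, fun g hg => ?_⟩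
    rcases key _ hg with h | h
    · rw [h]; exact (hp g h).imp Eq.symm Eq.symm
    · rw [h]; exact (hn g h).imp Eq.symm Eq.symm
  · have hYe : Y e = 1 := by rw [← neg_neg (Y e), ← hXY, h]; decide
    obtain ⟨Z, hZ, hZe, hp, hn⟩ := hO.elimination Y hY X hX
      (fun h' => hne (by rw [h', neg_neg])) e hYe h
    refine ⟨Z, hZ, hZe, fun g hg => ?_⟩
    rcases key _ hg with h | h
    · rw [h]; exact ((hp g h).imp Eq.symm Eq.symm).symm
    · rw [h]; exact ((hn g h).imp Eq.symm Eq.symm).symm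

lemma SignedSystem.IsOrientationOf.isCircuit_support (hO : O.IsOrientationOf M) {X : SignVec α}
    (hX : X ∈ O.circuits) : M.IsCircuit (Function.support X) :=
  (hO.2.2 _).2 ⟨X, hX, rfl⟩

lemma SignedSystem.IsOrientationOf.not_support_subset (hO : O.IsOrientationOf M) {X : SignVec α}
    (hX : X ∈ O.circuits) {I : Set α} (hI : M.Indep I) : ¬ Function.support X ⊆ I :=
  fun h => (hO.isCircuit_support hX).not_indep (hI.subset h)

/-- A cocircuit is minimal with nonspanning complement, so the complement becomes spanning as soon
as one element `e` of `D` is added to it. -/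
lemma Matroid.IsCocircuit.isBase_insert {D I : Set α} (hD : M.IsCocircuit D)
    (hI : M.IsBasis I (M.E \ D)) {e : α} (he : e ∈ D) : M.IsBase (insert e I) := by
  have hmin := Matroid.isCocircuit_iff_minimal_compl_nonspanning.1 hD
  have hDE := hD.subset_ground
  have hecl : e ∉ M.closure I := by
    intro h
    have h1 : M.Spanning (M.E \ (D \ {e})) := by
      by_contra hcon
      have := hmin.2 hcon Set.sdiff_subset he
      exact this.2 rfl
    apply hmin.1
    rw [Matroid.spanning_iff_ground_subset_closure] at h1 ⊢
    refine h1.trans (M.closure_subset_closure_of_subset_closure ?_)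
    rintro x ⟨hx, hxD⟩
    by_cases hxe : x = e
    · rw [hxe, ← hI.closure_eq_closure]; exact h
    · exact M.mem_closure_of_mem' ⟨hx, fun hx' => hxD ⟨hx', hxe⟩⟩
  have hindep : M.Indep (insert e I) :=
    hI.indep.insert_indep_iff.2 (Or.inl ⟨hDE he, hecl⟩)
  refine hindep.isBase_of_ground_subset_closure ?_
  have h1 : M.Spanning (M.E \ (D \ {e})) := by
    by_contra hcon
    have := hmin.2 hcon Set.sdiff_subset he
    exact this.2 rfl
  rw [Matroid.spanning_iff_ground_subset_closure] at h1
  refine h1.trans (M.closure_subset_closure_of_subset_closure ?_)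
  rintro x ⟨hx, hxD⟩
  by_cases hxe : x = e
  · rw [hxe]; exact M.mem_closure_of_mem (Set.mem_insert _ _) hindep.subset_ground
  · exact M.closure_subset_closure (Set.subset_insert _ _)
      (hI.subset_closure ⟨hx, fun hx' => hxD ⟨hx', hxe⟩⟩)

/-- Two elements outside of a hyperplane with basis `I` lie on a signed circuit that is otherwise
contained in `I`. -/
lemma SignedSystem.IsOrientationOf.exists_circuit_pair (hO : O.IsOrientationOf M) {I : Set α}
    {e f : α} (he : M.IsBase (insert e I)) (hf : M.IsBase (insert f I)) (hef : e ≠ f)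
    (hfI : f ∉ I) :
    ∃ X ∈ O.circuits, Function.support X ⊆ insert e (insert f I) := by
  have hC := he.fundCircuit_isCircuit (hf.subset_ground (Set.mem_insert _ _))
    (by simp [hef.symm, hfI])
  obtain ⟨X, hX, hXC⟩ := (hO.2.2 _).1 hC
  refine ⟨X, hX, hXC.trans_subset ?_⟩
  rw [Set.insert_comm]
  exact M.fundCircuit_subset_insert f _

lemma SignedSystem.IsOrientationOf.ne_zero_of_pair (hO : O.IsOrientationOf M) {I : Set α}
    {e f : α} (hf : M.Indep (insert f I)) {X : SignVec α} (hX : X ∈ O.circuits)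
    (hsub : Function.support X ⊆ insert e (insert f I)) : X e ≠ 0 := by
  intro h
  refine hO.not_support_subset hX hf fun g hg => ?_
  rcases hsub hg with rfl | h'
  · exact absurd h hg
  · exact h'

/-- `Y` is balanced on the signed circuits that have two elements outside of the hyperplane with
basis `I` and complement `D` and are otherwise contained in `I`. -/
def IsBalancedOn (O : SignedSystem α) (I D : Set α) (Y : SignVec α) : Prop :=
  ∀ e ∈ D, ∀ f ∈ D, e ≠ f → ∃ X ∈ O.circuits, Function.support X ⊆ insert e (insert f I) ∧
    X e * Y e = -(X f * Y f)

/-- Suppose that `X` meets `D` but no product with `Y` is negative. Eliminating an element of `D`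
from `X` with a balanced pair circuit gives another such circuit with fewer elements in `D`. It
still meets `D`, since `I` is independent, so the descent is impossible. The same argument for `-X`
provides the other sign. -/
lemma SignedSystem.IsOrientationOf.signOrthogonal_of_isBalancedOn (hO : O.IsOrientationOf M)
    {I D : Set α} (hfin : D.Finite) (hb : ∀ e ∈ D, M.IsBase (insert e I)) (hdj : Disjoint I D)
    {Y : SignVec α} (hY : Function.support Y = D) (hbal : IsBalancedOn O I D Y)
    {X : SignVec α} (hX : X ∈ O.circuits) (hXs : Function.support X ⊆ I ∪ D) :
    SignOrthogonal X Y := by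
  have key : ∀ n, ∀ X ∈ O.circuits, Function.support X ⊆ I ∪ D →
      (Function.support X ∩ D).ncard = n → (∃ g ∈ D, X g ≠ 0) → ¬ ∀ g, X g * Y g ≠ -1 := by
    intro n
    induction n using Nat.strong_induction_on with
    | _ n ih =>
    rintro X hX hXs rfl ⟨e, heD, hXe⟩ hpos
    have hYe : Y e ≠ 0 := by rw [← Function.mem_support, hY]; exact heD
    obtain ⟨f, hfD, hef, hXf⟩ : ∃ f ∈ D, f ≠ e ∧ X f ≠ 0 := by
      by_contra hcon
      push Not at hcon
      refine hO.not_support_subset hX (hb e heD).indep fun g hg => ?_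
      rcases hXs hg with h | h
      · exact Or.inr h
      · by_contra hge
        exact hg (hcon g h (fun h' => hge (Or.inl h')))
    have hYf : Y f ≠ 0 := by rw [← Function.mem_support, hY]; exact hfD
    -- Up to replacing `Z` by `-Z`, it opposes `X` at `e`; balance then makes it agree with `X` at
    -- `f`, so the elimination changes no surviving sign on `D`.
    obtain ⟨Z, hZ, hZs, hZe, hZf⟩ : ∃ Z ∈ O.circuits,
        Function.support Z ⊆ insert e (insert f I) ∧ X e = -Z e ∧ X f = Z f := by
      obtain ⟨Z, hZ, hZs, hZb⟩ := hbal e heD f hfD hef.symm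
      have hZe := hO.ne_zero_of_pair (hb f hfD).indep hZ hZs
      have hp1 := hpos e
      have hp2 := hpos f
      have hsign : ∀ xe xf ze zf ye yf : SignType, xe ≠ 0 → xf ≠ 0 → ze ≠ 0 → ye ≠ 0 → yf ≠ 0 →
          xe * ye ≠ -1 → xf * yf ≠ -1 → ze * ye = -(zf * yf) →
          (xe = -ze ∧ xf = zf) ∨ (xe = ze ∧ xf = -zf) := by decide
      rcases hsign _ _ _ _ _ _ hXe hXf hZe hYe hYf hp1 hp2 hZb with h | h
      · exact ⟨Z, hZ, hZs, h⟩
      · exact ⟨-Z, hO.1.neg_mem Z hZ, by rwa [SignVec.support_neg],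
          by simpa using h.1, by simpa using h.2⟩
    obtain ⟨W, hW, hWe, hWg⟩ := hO.1.exists_elimination hX hZ (by
      rintro rfl
      have hsign : ∀ z : SignType, -z ≠ 0 → -z ≠ z := by decide
      exact hsign _ hXf hZf) hXe hZe
    have hWD : ∀ g ∈ D, W g ≠ 0 → W g = X g := by
      intro g hg hWg0
      rcases hWg g hWg0 with h | h
      · exact h
      · have hgs : g ∈ Function.support Z := by rw [Function.mem_support, ← h]; exact hWg0
        rcases hZs hgs with rfl | rfl | h'
        · exact absurd hWe hWg0
        · rw [h, hZf]
        · exact absurd hg (Set.disjoint_left.1 hdj h')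
    have hWs : Function.support W ⊆ I ∪ D := by
      intro g hg
      rcases hWg g hg with h | h
      · exact hXs (by rw [Function.mem_support, ← h]; exact hg)
      · rcases hZs (show g ∈ Function.support Z by rw [Function.mem_support, ← h]; exact hg) with
          rfl | rfl | h'
        exacts [Or.inr heD, Or.inr hfD, Or.inl h']
    refine ih _ ?_ W hW hWs rfl ?_ fun g hg => ?_
    · refine Set.ncard_lt_ncard ?_ (hfin.inter_of_right _)
      refine ⟨fun g hg => ⟨?_, hg.2⟩, fun hcon => ?_⟩
      · rw [Function.mem_support, ← hWD g hg.2 hg.1]; exact hg.1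
      · exact (hcon ⟨hXe, heD⟩).1 hWe
    · by_contra hcon
      push Not at hcon
      refine hO.not_support_subset hW ((hb e heD).indep.subset (Set.subset_insert _ _))
        fun g hg => ?_
      rcases hWs hg with h | h
      · exact h
      · exact absurd (hcon g h) hg
    · have hWg0 : W g ≠ 0 := by
        intro h
        rw [h, zero_mul] at hg
        exact absurd hg (by decide)
      have hgD : g ∈ D := by
        rw [← hY, Function.mem_support]
        intro h
        rw [h, mul_zero] at hg
        exact absurd hg (by decide)
      rw [hWD g hgD hWg0] at hg
      exact hpos g hg
  by_cases hmeet : ∃ g ∈ D, X g ≠ 0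
  · have h1 := key _ X hX hXs rfl hmeet
    have h2 := key _ (-X) (hO.1.neg_mem X hX) (by rwa [SignVec.support_neg]) rfl
      (by simpa using hmeet)
    push Not at h1 h2
    obtain ⟨k, hk⟩ := h2
    refine Or.inr ⟨⟨k, ?_⟩, h1⟩
    rw [Pi.neg_apply, neg_mul, neg_inj] at hk
    exact hk
  · push Not at hmeet
    refine Or.inl fun g => ?_
    by_cases hg : g ∈ D
    · rw [hmeet g hg, zero_mul]
    · have : Y g = 0 := by
        by_contra h
        exact hg (hY ▸ h)
      rw [this, mul_zero]

/-- Fix `a` in `D` and give it the sign `1`. The pair circuit through `a` and `f` dictates the sign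
of `f`. For a pair avoiding `a`, eliminate `a` between the two circuits joining it to `e` and to
`f`. -/
lemma SignedSystem.IsOrientationOf.exists_isBalancedOn (hO : O.IsOrientationOf M)
    {I D : Set α} (hb : ∀ e ∈ D, M.IsBase (insert e I)) (hdj : Disjoint I D) (hne : D.Nonempty) :
    ∃ Y : SignVec α, Function.support Y = D ∧ IsBalancedOn O I D Y := by
  classical
  obtain ⟨a, ha⟩ := hne
  have hex : ∀ f, ∃ X : SignVec α, f ∈ D → f ≠ a →
      X ∈ O.circuits ∧ Function.support X ⊆ insert a (insert f I) := by
    intro f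
    by_cases hf : f ∈ D ∧ f ≠ a
    · obtain ⟨X, hX⟩ := hO.exists_circuit_pair (hb a ha) (hb f hf.1) hf.2.symm
        (Set.disjoint_right.1 hdj hf.1)
      exact ⟨X, fun _ _ => hX⟩
    · exact ⟨0, fun h1 h2 => absurd ⟨h1, h2⟩ hf⟩
  choose X hX using hex
  have hXa : ∀ f ∈ D, f ≠ a → X f a ≠ 0 := fun f hf hfa =>
    hO.ne_zero_of_pair (hb f hf).indep (hX f hf hfa).1 (hX f hf hfa).2
  have hXf : ∀ f ∈ D, f ≠ a → X f f ≠ 0 := fun f hf hfa =>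
    hO.ne_zero_of_pair (hb a ha).indep (hX f hf hfa).1
      (by rw [Set.insert_comm]; exact (hX f hf hfa).2)
  have hXo : ∀ f ∈ D, f ≠ a → ∀ g ∈ D, g ≠ a → g ≠ f → X f g = 0 := by
    intro f hf hfa g hg hga hgf
    by_contra h
    rcases (hX f hf hfa).2 h with h | h | h
    exacts [hga h, hgf h, Set.disjoint_left.1 hdj h hg]
  obtain ⟨Y, hYa, hYf, hY0⟩ : ∃ Y : SignVec α, Y a = 1 ∧
      (∀ f ∈ D, f ≠ a → Y f = -(X f a * X f f)) ∧ ∀ f ∉ D, Y f = 0 :=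
    ⟨fun f => if f = a then 1 else if f ∈ D then -(X f a * X f f) else 0, by simp,
      fun f hf hfa => by simp [hf, hfa], fun f hf => by
        have : f ≠ a := by rintro rfl; exact hf ha
        simp [hf, this]⟩
  refine ⟨Y, ?_, ?_⟩
  · ext f
    rw [Function.mem_support]
    by_cases hf : f ∈ D
    · simp only [hf, iff_true]
      by_cases hfa : f = a
      · rw [hfa, hYa]; decide
      · rw [hYf f hf hfa]
        have hsign : ∀ x y : SignType, x ≠ 0 → y ≠ 0 → -(x * y) ≠ 0 := by decide
        exact hsign _ _ (hXa f hf hfa) (hXf f hf hfa)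
    · simp [hf, hY0 f hf]
  · have hsign0 : ∀ x y : SignType, y ≠ 0 → x * 1 = -(y * -(x * y)) := by decide
    intro e he f hf hef
    by_cases hea : e = a
    · subst hea
      refine ⟨X f, (hX f hf hef.symm).1, (hX f hf hef.symm).2, ?_⟩
      rw [hYa, hYf f hf hef.symm]
      exact hsign0 _ _ (hXf f hf hef.symm)
    by_cases hfa : f = a
    · subst hfa
      refine ⟨X e, (hX e he hef).1, by rw [Set.insert_comm]; exact (hX e he hef).2, ?_⟩
      rw [hYa, hYf e he hef, hsign0 _ _ (hXf e he hef), neg_neg]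
    -- The formula for `Y f` does not change when the circuit is negated, so the sign at `a` can be
    -- chosen to permit elimination.
    · obtain ⟨Z, hZ, hZs, hZa, hZf⟩ : ∃ Z ∈ O.circuits,
          Function.support Z = Function.support (X f) ∧ X e a = -Z a ∧
            Y f = -(Z a * Z f) := by
        have hsign : ∀ x y : SignType, x ≠ 0 → y ≠ 0 → x = -y ∨ x = y := by decide
        rcases hsign _ _ (hXa e he hea) (hXa f hf hfa) with h | h
        · exact ⟨X f, (hX f hf hfa).1, rfl, h, hYf f hf hfa⟩
        · refine ⟨-X f, hO.1.neg_mem _ (hX f hf hfa).1, by rw [SignVec.support_neg],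
            by simpa using h, ?_⟩
          rw [hYf f hf hfa]
          simp
      have hZe : Z e = 0 := by
        have : e ∉ Function.support Z := by
          rw [hZs, Function.mem_support, hXo f hf hfa e he hea hef, not_not]
        simpa using this
      have hZf0 : Z f ≠ 0 := by
        rw [← Function.mem_support, hZs]
        exact hXf f hf hfa
      obtain ⟨W, hW, hWa, hWg⟩ := hO.1.exists_elimination (hX e he hea).1 hZ (by
        intro h
        have := congrFun h e
        rw [Pi.neg_apply, hZe] at this
        exact hXf e he hea (by rw [this]; decide)) (hXa e he hea) hZa
      have hWs : Function.support W ⊆ insert e (insert f I) := by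
        intro g hg
        have hga : g ≠ a := by rintro rfl; exact hg hWa
        rcases hWg g hg with h | h
        · have : g ∈ Function.support (X e) := by rw [Function.mem_support, ← h]; exact hg
          rcases (hX e he hea).2 this with h | h | h
          exacts [absurd h hga, Or.inl h, Or.inr (Or.inr h)]
        · have : g ∈ Function.support Z := by rw [Function.mem_support, ← h]; exact hg
          rw [hZs] at this
          rcases (hX f hf hfa).2 this with h | h | h
          exacts [absurd h hga, Or.inr (Or.inl h), Or.inr (Or.inr h)]
      have hWe := hO.ne_zero_of_pair (hb f hf).indep hW hWs
      have hWf := hO.ne_zero_of_pair (hb e he).indep hW (by rwa [Set.insert_comm])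
      have hWe' : W e = X e e := by
        rcases hWg e hWe with h | h
        · exact h
        · rw [hZe] at h; exact absurd h hWe
      have hWf' : W f = Z f := by
        rcases hWg f hWf with h | h
        · rw [hXo e he hea f hf hfa hef.symm] at h; exact absurd h hWf
        · exact h
      refine ⟨W, hW, hWs, ?_⟩
      rw [hWe', hWf', hYf e he hea, hZf, hZa]
      have hsign : ∀ x y z : SignType, x ≠ 0 → z ≠ 0 →
          x * -(-y * x) = -(z * -(y * z)) := by decide
      exact hsign _ _ _ (hXf e he hea) hZf0

/-- If a pair circuit uses the leaving element `b`, eliminate `b` with the fundamental circuit of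
the entering element `h`. That circuit lies in the hyperplane, so the signs on `D` are unaffected.
-/
lemma SignedSystem.IsOrientationOf.isBalancedOn_exchange (hO : O.IsOrientationOf M)
    {I J D : Set α} (hb : ∀ e ∈ D, M.IsBase (insert e I))
    (hI : M.IsBasis I (M.E \ D)) (hJ : M.Indep J)
    {b h : α} (hbI : b ∈ I) (hJe : J = insert h (I \ {b})) (hhI : h ∉ I) (hhD : h ∈ M.E \ D)
    (hJb : ∀ e ∈ D, M.IsBase (insert e J))
    {Y : SignVec α} (hbal : IsBalancedOn O I D Y) : IsBalancedOn O J D Y := by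
  have hdj : Disjoint I D := (Set.subset_sdiff.1 hI.subset).2
  intro e he f hf hef
  obtain ⟨Z, hZ, hZs, hZe⟩ := hbal e he f hf hef
  have hbJ : ∀ x ∈ I, x ≠ b → x ∈ J := fun x hx hxb => hJe ▸ Or.inr ⟨hx, hxb⟩
  by_cases hZb : Z b = 0
  · refine ⟨Z, hZ, fun g hg => ?_, hZe⟩
    rcases hZs hg with h' | h' | h'
    exacts [Or.inl h', Or.inr (Or.inl h'),
      Or.inr (Or.inr (hbJ g h' (by rintro rfl; exact hg hZb)))]
  have hC := hI.indep.fundCircuit_isCircuit (hI.subset_closure hhD) hhI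
  obtain ⟨K, hK, hKs⟩ := (hO.2.2 _).1 hC
  replace hKs : Function.support K ⊆ insert h I :=
    hKs.trans_subset (M.fundCircuit_subset_insert h I)
  have hKb : K b ≠ 0 := by
    intro h0
    refine hO.not_support_subset hK hJ fun g hg => ?_
    rcases hKs hg with rfl | h'
    · exact hJe ▸ Set.mem_insert _ _
    · exact hbJ g h' (by rintro rfl; exact hg h0)
  have hKD : ∀ g ∈ D, K g = 0 := by
    intro g hg
    by_contra h0
    rcases hKs h0 with rfl | h'
    · exact hhD.2 hg
    · exact Set.disjoint_left.1 hdj h' hg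
  obtain ⟨K', hK', hKs', hKb'⟩ : ∃ K' ∈ O.circuits,
      Function.support K' = Function.support K ∧ Z b = -K' b := by
    have hsign : ∀ x y : SignType, x ≠ 0 → y ≠ 0 → x = -y ∨ x = y := by decide
    rcases hsign _ _ hZb hKb with h' | h'
    · exact ⟨K, hK, rfl, h'⟩
    · exact ⟨-K, hO.1.neg_mem _ hK, by rw [SignVec.support_neg], by simpa using h'⟩
  have hKD' : ∀ g ∈ D, K' g = 0 := by
    intro g hg
    have : g ∉ Function.support K' := by rw [hKs', Function.mem_support, hKD g hg, not_not]
    simpa using this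
  have hZe0 := hO.ne_zero_of_pair (hb f hf).indep hZ hZs
  obtain ⟨W, hW, hWb, hWg⟩ := hO.1.exists_elimination hZ hK' (by
    intro h'
    have := congrFun h' e
    rw [Pi.neg_apply, hKD' e he] at this
    exact hZe0 (by rw [this]; decide)) hZb hKb'
  have hWs : Function.support W ⊆ insert e (insert f J) := by
    intro g hg
    have hgb : g ≠ b := by rintro rfl; exact hg hWb
    rcases hWg g hg with h' | h'
    · have : g ∈ Function.support Z := by rw [Function.mem_support, ← h']; exact hg
      rcases hZs this with h' | h' | h'
      exacts [Or.inl h', Or.inr (Or.inl h'), Or.inr (Or.inr (hbJ g h' hgb))]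
    · have : g ∈ Function.support K' := by rw [Function.mem_support, ← h']; exact hg
      rw [hKs'] at this
      rcases hKs this with rfl | h'
      · exact Or.inr (Or.inr (hJe ▸ Set.mem_insert _ _))
      · exact Or.inr (Or.inr (hbJ g h' hgb))
  have hWe := hO.ne_zero_of_pair (hJb f hf).indep hW hWs
  have hWf := hO.ne_zero_of_pair (hJb e he).indep hW (by rwa [Set.insert_comm])
  refine ⟨W, hW, hWs, ?_⟩
  have hWD : ∀ g ∈ D, W g ≠ 0 → W g = Z g := by
    intro g hg hg0
    rcases hWg g hg0 with h' | h'
    · exact h'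
    · rw [hKD' g hg] at h'; exact absurd h' hg0
  rw [hWD e he hWe, hWD f hf hWf, hZe]

/-- Each cocircuit of the underlying matroid is the support of a sign vector that is orthogonal to
all signed circuits. -/
theorem SignedSystem.IsOrientationOf.exists_signOrthogonal (hO : O.IsOrientationOf M)
    {D : Set α} (hD : M.IsCocircuit D) :
    ∃ Y : SignVec α, Function.support Y = D ∧ ∀ X ∈ O.circuits, SignOrthogonal X Y := by
  have hDE := hD.subset_ground
  have hEfin : M.E.Finite := hO.2.1 ▸ hO.1.finite
  have hbase : ∀ I, M.IsBasis I (M.E \ D) → ∀ e ∈ D, M.IsBase (insert e I) :=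
    fun I hI e he => hD.isBase_insert hI he
  have hdj : ∀ I, M.IsBasis I (M.E \ D) → Disjoint I D :=
    fun I hI => (Set.subset_sdiff.1 hI.subset).2
  obtain ⟨I, hI⟩ := M.exists_isBasis (M.E \ D)
  obtain ⟨Y, hY, hbal⟩ := hO.exists_isBalancedOn (hbase I hI) (hdj I hI) hD.nonempty
  -- `Y` is built from a single basis of the hyperplane, while each circuit below needs a basis
  -- containing its part outside `D`. Any two bases are linked by single exchanges.
  have hall : ∀ n, ∀ I J, M.IsBasis I (M.E \ D) → M.IsBasis J (M.E \ D) → (I \ J).ncard = n →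
      IsBalancedOn O I D Y → IsBalancedOn O J D Y := by
    intro n
    induction n with
    | zero =>
      intro I J hI hJ hn hbal
      rw [Set.ncard_eq_zero ((hEfin.subset hI.indep.subset_ground).subset Set.sdiff_subset),
        Set.sdiff_eq_empty] at hn
      rwa [← hI.eq_of_subset_indep hJ.indep hn hJ.subset]
    | succ n ih =>
      intro I J hI hJ hn hbal
      obtain ⟨b, hb⟩ : (I \ J).Nonempty := by
        rw [Set.nonempty_iff_ne_empty]
        intro h
        rw [h, Set.ncard_empty] at hn
        omega
      obtain ⟨y, hy, hK⟩ := hI.isBase_restrict.exchange hJ.isBase_restrict hb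
      rw [Matroid.isBase_restrict_iff] at hK
      refine ih _ J hK hJ ?_
        (hO.isBalancedOn_exchange (hbase I hI) hI hK.indep hb.1 rfl hy.2 (hJ.subset hy.1)
          (hbase _ hK) hbal)
      have h1 : insert y (I \ {b}) \ J = (I \ J) \ {b} := by
        ext x
        simp only [Set.mem_sdiff, Set.mem_insert_iff, Set.mem_singleton_iff]
        constructor
        · rintro ⟨rfl | h, h'⟩
          · exact absurd hy.1 h'
          · exact ⟨⟨h.1, h'⟩, h.2⟩
        · rintro ⟨⟨h1, h2⟩, h3⟩
          exact ⟨Or.inr ⟨h1, h3⟩, h2⟩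
      rw [h1, Set.ncard_sdiff_singleton_of_mem hb, hn]
      omega
  refine ⟨Y, hY, fun X hX => ?_⟩
  have hXc := hO.isCircuit_support hX
  by_cases hmeet : Disjoint (Function.support X) D
  · refine Or.inl fun g => ?_
    by_cases hg : X g = 0
    · rw [hg, zero_mul]
    · have : g ∉ Function.support Y := by rw [hY]; exact Set.disjoint_left.1 hmeet hg
      rw [Function.notMem_support.1 this, mul_zero]
  · have hind : M.Indep (Function.support X \ D) := by
      refine hXc.ssubset_indep ⟨Set.sdiff_subset, fun hcon => hmeet ?_⟩
      exact Set.disjoint_left.2 fun g hg => (hcon hg).2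
    obtain ⟨J, hJ, hXJ⟩ := hind.subset_isBasis_of_subset
      (Set.sdiff_subset_sdiff_left (t := D) hXc.subset_ground)
    refine hO.signOrthogonal_of_isBalancedOn (hEfin.subset hDE) (hbase J hJ) (hdj J hJ) hY
      (hall _ I J hI hJ rfl hbal) hX fun g hg => ?_
    by_cases hgD : g ∈ D
    · exact Or.inr hgD
    · exact Or.inl (hXJ ⟨hg, hgD⟩)

end SignedCocircuits

/-! ### Coflows in rank two -/

section RankTwo

variable {α : Type*}

/-- The subgroup of `α → ℤ` generated by a set of sign vectors. -/
def signLattice (𝒴 : Set (SignVec α)) : AddSubgroup (α → ℤ) :=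
  AddSubgroup.closure ((fun (Y : SignVec α) (e : α) => (Y e : ℤ)) '' 𝒴)

lemma coe_mem_signLattice {𝒴 : Set (SignVec α)} {Y : SignVec α} (hY : Y ∈ 𝒴) :
    (fun e => (Y e : ℤ)) ∈ signLattice 𝒴 :=
  AddSubgroup.subset_closure ⟨Y, hY, rfl⟩

lemma signLattice_mono {𝒴 𝒵 : Set (SignVec α)} (h : 𝒴 ⊆ 𝒵) : signLattice 𝒴 ≤ signLattice 𝒵 :=
  AddSubgroup.closure_mono (Set.image_mono h)

lemma signLattice_apply_eq_zero {𝒴 : Set (SignVec α)} {e : α} (h : ∀ Y ∈ 𝒴, Y e = 0)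
    {x : α → ℤ} (hx : x ∈ signLattice 𝒴) : x e = 0 := by
  induction hx using AddSubgroup.closure_induction with
  | mem x hx =>
    obtain ⟨Y, hY, rfl⟩ := hx
    simp [h Y hY]
  | zero => rfl
  | add x y _ _ hx hy => simp [hx, hy]
  | neg x _ hx => simp [hx]

lemma signLattice_abs_eq {𝒴 : Set (SignVec α)} {e f : α} {s : ℤ} (hs : |s| = 1)
    (h : ∀ Y ∈ 𝒴, (Y f : ℤ) = s * Y e) {x : α → ℤ} (hx : x ∈ signLattice 𝒴) :
    |x f| = |x e| := by
  have : x f = s * x e := by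
    induction hx using AddSubgroup.closure_induction with
    | mem x hx =>
      obtain ⟨Y, hY, rfl⟩ := hx
      exact h Y hY
    | zero => simp
    | add x y _ _ hx hy => simp only [Pi.add_apply, hx, hy]; ring
    | neg x _ hx => simp [hx]
  rw [this, abs_mul, hs, one_mul]

/-- The family `s` of sign vectors behaves like the signed cocircuits of an oriented matroid of
rank two without loops: `s x` vanishes on the elements of `V` that are parallel to `x`. The last
two fields express orthogonality to the signed circuits with two and with three elements. -/
structure IsRankTwoFamily (V : Set α) (s : α → SignVec α) : Prop where
  finite : V.Finite
  refl : ∀ x ∈ V, s x x = 0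
  symm : ∀ x ∈ V, ∀ y ∈ V, s x y = 0 → s y x = 0
  trans : ∀ x ∈ V, ∀ y ∈ V, ∀ z ∈ V, s x y = 0 → s y z = 0 → s x z = 0
  pair : ∀ x ∈ V, ∀ x' ∈ V, ∀ y ∈ V, ∀ z ∈ V, s x x' = 0 → s y x ≠ 0 → s z x ≠ 0 →
    s y x * s y x' = s z x * s z x'
  triple : ∀ x ∈ V, ∀ y ∈ V, ∀ z ∈ V, s x y ≠ 0 → s y z ≠ 0 → s x z ≠ 0 →
    ∃ a b c : SignType, a ≠ 0 ∧ b ≠ 0 ∧ c ≠ 0 ∧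
      b * s x y = -(c * s x z) ∧ a * s y x = -(c * s y z) ∧ a * s z x = -(b * s z y) ∧
      ∀ w ∈ V, s w x ≠ 0 → s w y ≠ 0 → s w z ≠ 0 →
        ¬ (a * s w x = b * s w y ∧ b * s w y = c * s w z)

/-- The sign of `y` in `s x`, after a reorientation that makes `s e` positive and after a change of
sign that makes `s x` negative at `e`. -/
def relSign (s : α → SignVec α) (e x y : α) : SignType :=
  -(s x e * s x y * s e y)

namespace IsRankTwoFamily

variable {V : Set α} {s : α → SignVec α} {e x y z : α}

lemma relSign_eq_zero (h : IsRankTwoFamily V s) (he : e ∈ V) (hpar : ∀ g ∈ V, s e g = 0 → g = e)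
    (hx : x ∈ V) (hy : y ∈ V) (hxe : x ≠ e) (hye : y ≠ e) :
    relSign s e x y = 0 ↔ s x y = 0 := by
  have h1 : s e y ≠ 0 := fun h0 => hye (hpar y hy h0)
  have h2 : s x e ≠ 0 := fun h0 => hxe (hpar x hx (h.symm x hx e he h0))
  have key : ∀ a b c : SignType, a ≠ 0 → c ≠ 0 → (-(a * b * c) = 0 ↔ b = 0) := by decide
  exact key _ _ _ h2 h1

/-- Obtained from the circuit on `e`, `x`, `y` by orthogonality to `s e`, `s x` and `s y`. With
transitivity, `relSign` becomes a linear order on the parallel classes other than that of `e`, where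
`1` means that `x` is below `y`. -/
lemma relSign_antisymm (h : IsRankTwoFamily V s) (he : e ∈ V)
    (hpar : ∀ g ∈ V, s e g = 0 → g = e) (hx : x ∈ V) (hy : y ∈ V) (hxe : x ≠ e) (hye : y ≠ e) :
    relSign s e y x = -relSign s e x y := by
  by_cases hxy : s x y = 0
  · rw [(h.relSign_eq_zero he hpar hx hy hxe hye).2 hxy,
      (h.relSign_eq_zero he hpar hy hx hye hxe).2 (h.symm x hx y hy hxy), neg_zero]
  have h1 : s e x ≠ 0 := fun h0 => hxe (hpar x hx h0)
  have h2 : s e y ≠ 0 := fun h0 => hye (hpar y hy h0)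
  obtain ⟨a, b, c, ha, hb, hc, hbc, hac, hab, -⟩ := h.triple e he x hx y hy h1 hxy h2
  have hyx : s y x ≠ 0 := fun h0 => hxy (h.symm y hy x hx h0)
  have key1 : ∀ a c p q r : SignType, a ≠ 0 → q ≠ 0 → a * p = -(c * q) →
      -(p * q * r) = a * (c * r) := by decide
  unfold relSign
  rw [key1 a c _ _ (s e y) ha hxy hac, key1 a b _ _ (s e x) ha hyx hab, hbc, mul_neg]

lemma relSign_congr_right (h : IsRankTwoFamily V s) (he : e ∈ V)
    (hpar : ∀ g ∈ V, s e g = 0 → g = e) (hx : x ∈ V) (hy : y ∈ V) (hz : z ∈ V)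
    (hye : y ≠ e) (hxy : s x y ≠ 0) (hyz : s y z = 0) :
    relSign s e x y = relSign s e x z := by
  have h1 : s e y ≠ 0 := fun h0 => hye (hpar y hy h0)
  have h2 := h.pair y hy z hz x hx e he hyz hxy h1
  have h3 : s e z ≠ 0 := by
    intro h0
    obtain rfl := hpar z hz h0
    exact h1 (h.symm y hy z hz hyz)
  have key : ∀ p a b c d : SignType, a ≠ 0 → c ≠ 0 → d ≠ 0 → a * b = c * d →
      -(p * a * c) = -(p * b * d) := by decide
  exact key _ _ _ _ _ hxy h1 h3 h2

/-- For a cyclic triple, the circuit on `x`, `y`, `z` would have equal products with `s e` at all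
three elements, against orthogonality. -/
lemma relSign_trans (h : IsRankTwoFamily V s) (he : e ∈ V)
    (hpar : ∀ g ∈ V, s e g = 0 → g = e) (hx : x ∈ V) (hy : y ∈ V) (hz : z ∈ V)
    (hxe : x ≠ e) (hye : y ≠ e) (hze : z ≠ e)
    (hxy : relSign s e x y = 1) (hyz : relSign s e y z = 1) : relSign s e x z = 1 := by
  have hne : ∀ {u v}, u ∈ V → v ∈ V → u ≠ e → v ≠ e → relSign s e u v = 1 → s u v ≠ 0 := by
    intro u v hu hv hue hve huv h0
    rw [(h.relSign_eq_zero he hpar hu hv hue hve).2 h0] at huv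
    exact absurd huv (by decide)
  have hxy0 := hne hx hy hxe hye hxy
  have hyz0 := hne hy hz hye hze hyz
  have hyx := h.relSign_antisymm he hpar hx hy hxe hye
  rw [hxy] at hyx
  have hxz0 : s x z ≠ 0 := by
    intro h0
    have := h.relSign_congr_right he hpar hy hx hz hxe
      (fun h1 => hxy0 (h.symm y hy x hx h1)) h0
    rw [hyx, hyz] at this
    exact absurd this (by decide)
  by_contra hcon
  have hxz : relSign s e x z = -1 := by
    have h1 : relSign s e x z ≠ 0 := fun h0 =>
      hxz0 ((h.relSign_eq_zero he hpar hx hz hxe hze).1 h0)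
    have key : ∀ a : SignType, a ≠ 1 → a ≠ 0 → a = -1 := by decide
    exact key _ hcon h1
  obtain ⟨a, b, c, ha, hb, hc, hbc, hac, hab, hw⟩ := h.triple x hx y hy z hz hxy0 hyz0 hxz0
  have hne' : ∀ {u}, u ∈ V → u ≠ e → s e u ≠ 0 := fun hu hue h0 => hue (hpar _ hu h0)
  -- normalised signs of the circuit through `x`, `y`, `z`
  have key : ∀ p q r u v b c : SignType, b * q = -(c * r) → -(p * q * u) = 1 →
      -(p * r * v) = -1 → b * u = c * v := by decide
  have key' : ∀ p q r u v b c : SignType, b * q = -(c * r) → -(p * q * u) = -1 →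
      -(p * r * v) = 1 → b * u = c * v := by decide
  have h1 : b * s e y = c * s e z := key _ _ _ _ _ _ _ hbc hxy hxz
  have h2 : a * s e x = c * s e z := key' _ _ _ _ _ _ _ hac hyx hyz
  exact hw e he (hne' hx hxe) (hne' hy hye) (hne' hz hze) ⟨h2.trans h1.symm, h1⟩

/-- Induction on the number of elements below `x`. For neighbouring classes `x'` below `x`, and up
to the signs of `s e`, the difference of their rows is `1` on both classes and `0` elsewhere, also
at `e`. Subtracting a multiple moves the support from one class to the next. -/
lemma exists_mem_signLattice (h : IsRankTwoFamily V s) (he : e ∈ V)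
    (hpar : ∀ g ∈ V, s e g = 0 → g = e) (hx : x ∈ V) (hxe : x ≠ e) :
    ∃ z ∈ signLattice (s '' V), z e = 1 ∧ ∃ σ : ℤ, |σ| = 1 ∧ ∀ g ∈ V, g ≠ e →
      z g = if s x g = 0 then σ * (s e g : ℤ) else 0 := by
  classical
  set W : Set α := {y | y ∈ V ∧ y ≠ e} with hW
  set below : α → Set α := fun x => {y | y ∈ W ∧ relSign s e y x = 1} with hbelow
  have hfin : ∀ x, (below x).Finite := fun x => h.finite.subset fun y hy => hy.1.1
  -- the row of `x`, negative at `e`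
  obtain ⟨row, hrow, hrowe, hrowg⟩ : ∃ row : α → α → ℤ,
      (∀ x ∈ W, row x ∈ signLattice (s '' V)) ∧ (∀ x ∈ W, row x e = -1) ∧
      ∀ x ∈ W, ∀ g ∈ W, row x g = relSign s e x g * s e g := by
    refine ⟨fun x g => -(s x e : ℤ) * s x g, ?_, ?_, ?_⟩
    · intro x hx
      have hm := coe_mem_signLattice (Set.mem_image_of_mem s hx.1)
      convert AddSubgroup.zsmul_mem _ hm (-(s x e : ℤ)) using 1
      funext g
      simp
    · intro x hx
      have h0 : s x e ≠ 0 := fun h0 => hx.2 (hpar x hx.1 (h.symm x hx.1 e he h0))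
      have key : ∀ a : SignType, a ≠ 0 → -(a : ℤ) * a = -1 := by decide
      exact key _ h0
    · intro x hx g hg
      have h0 : s e g ≠ 0 := fun h0 => hg.2 (hpar g hg.1 h0)
      have key : ∀ a b c : SignType, c ≠ 0 →
          -(a : ℤ) * b = (-(a * b * c) : SignType) * (c : ℤ) := by decide
      exact key _ _ _ h0
  have hanti : ∀ x ∈ W, ∀ y ∈ W, relSign s e y x = -relSign s e x y := fun x hx y hy =>
    h.relSign_antisymm he hpar hx.1 hy.1 hx.2 hy.2
  have htrans : ∀ x ∈ W, ∀ y ∈ W, ∀ z ∈ W, relSign s e x y = 1 → relSign s e y z = 1 →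
      relSign s e x z = 1 := fun x hx y hy z hz =>
    h.relSign_trans he hpar hx.1 hy.1 hz.1 hx.2 hy.2 hz.2
  have hzero : ∀ x ∈ W, ∀ y ∈ W, (relSign s e x y = 0 ↔ s x y = 0) := fun x hx y hy =>
    h.relSign_eq_zero he hpar hx.1 hy.1 hx.2 hy.2
  have hcongr : ∀ x ∈ W, ∀ y ∈ W, ∀ z ∈ W, s x y ≠ 0 → s y z = 0 →
      relSign s e x y = relSign s e x z := fun x hx y hy z hz =>
    h.relSign_congr_right he hpar hx.1 hy.1 hz.1 hy.2
  have hcases : ∀ a : SignType, a = 0 ∨ a = 1 ∨ a = -1 := by decide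
  have hlt : ∀ x ∈ W, ∀ y ∈ W, relSign s e x y = 1 → (below x).ncard < (below y).ncard := by
    intro x hx y hy hxy
    refine Set.ncard_lt_ncard ⟨fun z hz => ⟨hz.1, htrans z hz.1 x hx y hy hz.2 hxy⟩, fun hcon => ?_⟩
      (hfin y)
    have h1 := (hcon ⟨hx, hxy⟩ : x ∈ below x).2
    rw [(hzero x hx x hx).2 (h.refl x hx.1)] at h1
    exact absurd h1 (by decide)
  have key : ∀ n, ∀ x ∈ W, (below x).ncard = n → ∃ z ∈ signLattice (s '' V), z e = 1 ∧
      ∃ σ : ℤ, |σ| = 1 ∧ ∀ g ∈ W, z g = if s x g = 0 then σ * (s e g : ℤ) else 0 := by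
    intro n
    induction n using Nat.strong_induction_on with
    | _ n ih =>
    rintro x hx rfl
    by_cases hemp : (below x).Nonempty
    -- A maximal choice puts `x'` in the class immediately below `x`.
    · obtain ⟨x', hx', hmax⟩ := Set.exists_max_image (below x) (fun y => (below y).ncard)
        (hfin x) hemp
      obtain ⟨hx'W, hx'x⟩ := hx'
      obtain ⟨z, hz, hze, σ, hσ, hzg⟩ := ih _ (hlt x' hx'W x hx hx'x) x' hx'W rfl
      have hxx' : relSign s e x x' = -1 := by rw [hanti x' hx'W x hx, hx'x]
      have hs1 : s x' x ≠ 0 := by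
        rw [Ne, ← hzero x' hx'W x hx, hx'x]; decide
      have hs2 : s x x' ≠ 0 := by
        rw [Ne, ← hzero x hx x' hx'W, hxx']; decide
      -- On the class of `x'` the values cancel, and on the class of `x` the factor becomes `-σ`.
      refine ⟨z - σ • (row x' - row x), sub_mem hz (AddSubgroup.zsmul_mem _
        (sub_mem (hrow x' hx'W) (hrow x hx)) σ), ?_, -σ, by rwa [abs_neg], fun g hg => ?_⟩
      · simp [hze, hrowe x' hx'W, hrowe x hx]
      · simp only [Pi.sub_apply, Pi.smul_apply, smul_eq_mul, hzg g hg, hrowg x' hx'W g hg,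
          hrowg x hx g hg]
        rcases hcases (relSign s e x' g) with h1 | h1 | h1
        · have h2 := (hzero x' hx'W g hg).1 h1
          have h3 : relSign s e x g = -1 := by
            rw [← hcongr x hx x' hx'W g hg hs2 h2, hxx']
          have h4 : s x g ≠ 0 := by rw [Ne, ← hzero x hx g hg, h3]; decide
          rw [if_pos h2, if_neg h4, h1, h3]
          simp
        · have h2 : s x' g ≠ 0 := by rw [Ne, ← hzero x' hx'W g hg, h1]; decide
          rw [if_neg h2, h1]
          rcases hcases (relSign s e x g) with h3 | h3 | h3
          · rw [if_pos ((hzero x hx g hg).1 h3), h3]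
            simp
          · have h4 : s x g ≠ 0 := by rw [Ne, ← hzero x hx g hg, h3]; decide
            rw [if_neg h4, h3]
            simp
          -- Here `g` would lie strictly between `x'` and `x`.
          · exfalso
            have h4 : relSign s e g x = 1 := by rw [hanti x hx g hg, h3]; decide
            have h5 := hmax g ⟨hg, h4⟩
            have h6 := hlt x' hx'W g hg h1
            omega
        · have h2 : s x' g ≠ 0 := by rw [Ne, ← hzero x' hx'W g hg, h1]; decide
          have h3 : relSign s e g x' = 1 := by rw [hanti x' hx'W g hg, h1]; decide
          have h4 : relSign s e x g = -1 := by
            rw [hanti g hg x hx, htrans g hg x' hx'W x hx h3 hx'x]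
          have h5 : s x g ≠ 0 := by rw [Ne, ← hzero x hx g hg, h4]; decide
          rw [if_neg h2, if_neg h5, h1, h4]
          simp
    -- For the lowest class, the row of `x` agrees with `s e` on every higher class.
    · refine ⟨(fun g => (s e g : ℤ)) - row x, sub_mem
        (coe_mem_signLattice (Set.mem_image_of_mem s he)) (hrow x hx), ?_, 1, by simp,
        fun g hg => ?_⟩
      · simp [h.refl e he, hrowe x hx]
      · simp only [Pi.sub_apply, hrowg x hx g hg]
        rcases hcases (relSign s e x g) with h3 | h3 | h3
        · rw [if_pos ((hzero x hx g hg).1 h3), h3]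
          simp
        · have h4 : s x g ≠ 0 := by rw [Ne, ← hzero x hx g hg, h3]; decide
          rw [if_neg h4, h3]
          simp
        · have h4 : relSign s e g x = 1 := by rw [hanti x hx g hg, h3]; decide
          exact absurd ⟨g, hg, h4⟩ hemp
  obtain ⟨z, hz, hze, σ, hσ, hzg⟩ := key _ x ⟨hx, hxe⟩ rfl
  exact ⟨z, hz, hze, σ, hσ, fun g hg hge => hzg g ⟨hg, hge⟩⟩

end IsRankTwoFamily

end RankTwo

/-! ### Orthogonal pairs of signatures of a matroid and its dual -/

section DualPair

open scoped Matroid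

variable {α : Type*} {N M : Matroid α} {𝒳 𝒴 : Set (SignVec α)}

/-- Every circuit of `N` is the trace on the ground set of a member of `𝒳`, every cocircuit is the
trace of a member of `𝒴`, and the members of `𝒳` are orthogonal to those of `𝒴` on the ground
set. -/
structure IsDualPair (N : Matroid α) (𝒳 𝒴 : Set (SignVec α)) : Prop where
  finite : N.E.Finite
  exists_circuit : ∀ C, N.IsCircuit C → ∃ X ∈ 𝒳, Function.support X ∩ N.E = C
  exists_cocircuit : ∀ D, N.IsCocircuit D → ∃ Y ∈ 𝒴, Function.support Y ∩ N.E = D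
  orthogonal : ∀ X ∈ 𝒳, ∀ Y ∈ 𝒴, SignOrthogonal X Y
  mul_eq_zero : ∀ X ∈ 𝒳, ∀ Y ∈ 𝒴, ∀ e ∉ N.E, X e * Y e = 0

lemma SignOrthogonal.symm {X Y : SignVec α} (h : SignOrthogonal X Y) : SignOrthogonal Y X := by
  unfold SignOrthogonal at h ⊢
  simpa only [mul_comm] using h

/-- An element with a clone has no parallel elements in a contraction of rank two in which it is
not parallel to the clone. -/
lemma AreClones.eq_of_mem_closure_insert {L : Set α} {a b g : α} (hab : AreClones N a b)
    (haL : a ∉ L) (hbL : b ∉ L) (hB : N.IsBase (insert a (insert b L)))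
    (hg : g ∈ N.E \ N.closure L) (hga : g ∈ N.closure (insert a L)) : g = a := by
  by_contra hne
  have hnab := hab.2.2.1
  have hBi := hB.indep
  rw [Set.insert_comm] at hBi
  have hia : N.Indep (insert a L) := hBi.subset (Set.subset_insert _ _)
  have hi : N.Indep L := hia.subset (Set.subset_insert _ _)
  have hba : b ∉ N.closure (insert a L) :=
    ((hia.insert_indep_iff.1 hBi).resolve_right (by simp [hnab.symm, hbL])).2
  have hgL : g ∉ L := fun h' => hg.2 (N.mem_closure_of_mem h' hi.subset_ground)
  have hgb : g ≠ b := by rintro rfl; exact hba hga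
  have hcl : N.closure (insert g L) = N.closure (insert a L) :=
    Matroid.closure_insert_congr ⟨hga, hg.2⟩
  have hig : N.Indep (insert g L) := hi.insert_indep_iff.2 (Or.inl hg)
  have hibg : N.Indep (insert b (insert g L)) :=
    hig.insert_indep_iff.2 (Or.inl ⟨hab.2.1, hcl ▸ hba⟩)
  have hBg : N.IsBase (insert b (insert g L)) := by
    refine hibg.isBase_of_ground_subset_closure ?_
    rw [← N.closure_insert_closure_eq_closure_insert, hcl,
      N.closure_insert_closure_eq_closure_insert, Set.insert_comm, hB.closure_eq]
  -- Since `g` is parallel to `a`, it can replace `a` in the base; exchanging `b` for its clone `a`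
  -- would then put the parallel pair `a`, `g` into one base.
  have hBx := hab.symm.isBase_exchange hBg (Set.mem_insert _ _)
    (by simp [hnab, Ne.symm hne, haL])
  rw [Set.insert_sdiff_self_of_notMem (by simp [hgb.symm, hbL]), Set.insert_comm] at hBx
  exact ((hia.insert_indep_iff.1 hBx.indep).resolve_right (by simp [hne, hgL])).2 hga

namespace IsDualPair

lemma dual (h : IsDualPair N 𝒳 𝒴) : IsDualPair N✶ 𝒴 𝒳 where
  finite := h.finite
  exists_circuit := h.exists_cocircuit
  exists_cocircuit D hD := h.exists_circuit D (Matroid.dual_isCocircuit_iff.1 hD)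
  orthogonal X hX Y hY := (h.orthogonal Y hY X hX).symm
  mul_eq_zero X hX Y hY e he := by rw [mul_comm]; exact h.mul_eq_zero Y hY X hX e he

/-- Working with traces allows a minor to be reached by passing to subfamilies without altering any
vector. Coflows of the minor are then literally coflows of the original pair. -/
lemma contract (h : IsDualPair N 𝒳 𝒴) {A : Set α} (hA : A ⊆ N.E) :
    IsDualPair (N ／ A) 𝒳 {Y ∈ 𝒴 | ∀ e ∈ A, Y e = 0} where
  finite := h.finite.subset Set.sdiff_subset
  exists_circuit C hC := by
    obtain ⟨C', hC', h1, h2⟩ := hC.exists_subset_isCircuit_of_contract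
    obtain ⟨X, hX, hXC⟩ := h.exists_circuit C' hC'
    refine ⟨X, hX, ?_⟩
    have hCA : Disjoint C A := (Set.subset_sdiff.1 hC.subset_ground).2
    rw [Matroid.contract_ground, ← Set.inter_sdiff_assoc, hXC]
    ext g
    refine ⟨fun hg => (h2 hg.1).resolve_right hg.2, fun hg => ⟨h1 hg, ?_⟩⟩
    exact Set.disjoint_left.1 hCA hg
  exists_cocircuit D hD := by
    obtain ⟨hD', hDA⟩ := Matroid.contract_isCocircuit_iff.1 hD
    obtain ⟨Y, hY, hYD⟩ := h.exists_cocircuit D hD'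
    refine ⟨Y, ⟨hY, fun e he => ?_⟩, ?_⟩
    · by_contra h0
      exact Set.disjoint_right.1 hDA he (hYD ▸ ⟨h0, hA he⟩)
    · rw [Matroid.contract_ground, ← Set.inter_sdiff_assoc, hYD, hDA.sdiff_eq_left]
  orthogonal X hX Y hY := h.orthogonal X hX Y hY.1
  mul_eq_zero X hX Y hY e he := by
    by_cases heA : e ∈ A
    · rw [hY.2 e heA, mul_zero]
    · exact h.mul_eq_zero X hX Y hY.1 e fun heE => he ⟨heE, heA⟩

lemma delete (h : IsDualPair N 𝒳 𝒴) {A : Set α} (hA : A ⊆ N.E) :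
    IsDualPair (N ＼ A) {X ∈ 𝒳 | ∀ e ∈ A, X e = 0} 𝒴 := by
  rw [← Matroid.dual_contract_dual]
  exact (h.dual.contract (A := A) hA).dual

/-- The traces on `V` of the cocircuits avoiding an independent set `L` of corank two form a
family of rank two. -/
lemma exists_isRankTwoFamily (h : IsDualPair N 𝒳 𝒴) {L : Set α} {e f : α} (he : e ∉ L)
    (hf : f ∉ L) (hef : e ≠ f) (hB : N.IsBase (insert e (insert f L))) :
    ∃ s : α → SignVec α, (∀ x ∈ N.E \ N.closure L, s x ∈ 𝒴) ∧
      (∀ x ∈ N.E \ N.closure L, ∀ g ∈ N.E, s x g = 0 ↔ g ∈ N.closure (insert x L)) ∧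
      IsRankTwoFamily (N.E \ N.closure L) s := by
  have hL : N.Indep L := hB.indep.subset
    ((Set.subset_insert _ _).trans (Set.subset_insert _ _))
  have hLE := hL.subset_ground
  set V := N.E \ N.closure L with hV
  have hind : ∀ x ∈ V, N.Indep (insert x L) := fun x hx => hL.insert_indep_iff.2 (Or.inl hx)
  have hcongr : ∀ x ∈ V, ∀ y ∈ V, y ∈ N.closure (insert x L) →
      N.closure (insert y L) = N.closure (insert x L) := fun x _ y hy hyx =>
    Matroid.closure_insert_congr ⟨hyx, hy.2⟩
  have hbase : ∀ x ∈ V, ∀ y ∈ V, y ∉ N.closure (insert x L) →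
      N.IsBase (insert y (insert x L)) := by
    intro x hx y hy hyx
    have hi : N.Indep (insert y (insert x L)) :=
      (hind x hx).insert_indep_iff.2 (Or.inl ⟨hy.1, hyx⟩)
    obtain ⟨B, hBb, hBs⟩ := hi.exists_isBase_superset
    have hLfin : L.Finite := h.finite.subset hLE
    have hxL : x ∉ L := fun hxL => hx.2 (N.mem_closure_of_mem hxL)
    have hyL : y ∉ insert x L := fun hyL => hyx (N.mem_closure_of_mem hyL (hind x hx).subset_ground)
    have hcard : B.ncard ≤ (insert y (insert x L)).ncard := by
      rw [hBb.ncard_eq_ncard_of_isBase hB, Set.ncard_insert_of_notMem hyL (hLfin.insert _),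
        Set.ncard_insert_of_notMem hxL hLfin,
        Set.ncard_insert_of_notMem (by simp [hef, he]) (hLfin.insert _),
        Set.ncard_insert_of_notMem hf hLfin]
    rwa [Set.eq_of_subset_of_ncard_le hBs hcard (h.finite.subset hBb.subset_ground)]
  have hfL : N.Indep (insert f L) := hB.indep.subset (Set.subset_insert _ _)
  have heL : N.Indep (insert e L) := hB.indep.subset
    (Set.insert_subset_insert (Set.subset_insert _ _))
  have heV : e ∈ V := (hL.insert_indep_iff.1 heL).resolve_right he
  have hfV : f ∈ V := (hL.insert_indep_iff.1 hfL).resolve_right hf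
  have hfe : e ∉ N.closure (insert f L) :=
    ((hfL.insert_indep_iff.1 hB.indep).resolve_right (by simp [hef, he])).2
  have hother : ∀ x ∈ V, ∃ y ∈ V, y ∉ N.closure (insert x L) := by
    intro x hx
    by_contra hcon
    push Not at hcon
    exact hfe (by rw [hcongr x hx f hfV (hcon f hfV)]; exact hcon e heV)
  have hex : ∀ x, ∃ Y : SignVec α, x ∈ V → Y ∈ 𝒴 ∧
      ∀ g ∈ N.E, Y g = 0 ↔ g ∈ N.closure (insert x L) := by
    intro x
    by_cases hx : x ∈ V
    · obtain ⟨y, hy, hyx⟩ := hother x hx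
      have hD := (hbase x hx y hy hyx).compl_closure_sdiff_singleton_isCocircuit
        (Set.mem_insert _ _)
      have hyL : y ∉ insert x L := fun hyL =>
        hyx (N.mem_closure_of_mem hyL (hind x hx).subset_ground)
      rw [Set.insert_sdiff_self_of_notMem hyL] at hD
      obtain ⟨Y, hY, hYD⟩ := h.exists_cocircuit _ hD
      refine ⟨Y, fun _ => ⟨hY, fun g hg => ?_⟩⟩
      have h1 : g ∈ Function.support Y ∩ N.E ↔ g ∈ N.E \ N.closure (insert x L) := by rw [hYD]
      simp only [Set.mem_inter_iff, Function.mem_support, hg, and_true, Set.mem_sdiff,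
        true_and] at h1
      exact not_iff_not.1 h1
    · exact ⟨0, fun hx' => absurd hx' hx⟩
  choose s hs using hex
  have hs0 : ∀ x ∈ V, ∀ g ∈ N.E, s x g = 0 ↔ g ∈ N.closure (insert x L) := fun x hx => (hs x hx).2
  have hself : ∀ x ∈ V, x ∈ N.closure (insert x L) := fun x hx =>
    N.mem_closure_of_mem (Set.mem_insert _ _) (hind x hx).subset_ground
  have hsL : ∀ x ∈ V, ∀ g ∈ L, s x g = 0 := fun x hx g hg => (hs0 x hx g (hLE hg)).2
    (N.mem_closure_of_mem (Set.mem_insert_of_mem _ hg) (hind x hx).subset_ground)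
  refine ⟨s, fun x hx => (hs x hx).1, hs0, ?_⟩
  have hsymm : ∀ x ∈ V, ∀ y ∈ V, y ∈ N.closure (insert x L) → x ∈ N.closure (insert y L) := by
    intro x hx y hy hyx
    rw [hcongr x hx y hy hyx]
    exact hself x hx
  refine ⟨h.finite.subset Set.sdiff_subset, fun x hx => (hs0 x hx x hx.1).2 (hself x hx),
    ?_, ?_, ?_, ?_⟩
  · intro x hx y hy hxy
    rw [hs0 x hx y hy.1] at hxy
    rw [hs0 y hy x hx.1]
    exact hsymm x hx y hy hxy
  · intro x hx y hy z hz hxy hyz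
    rw [hs0 x hx y hy.1] at hxy
    rw [hs0 y hy z hz.1, hcongr x hx y hy hxy] at hyz
    rwa [hs0 x hx z hz.1]
  · intro x hx x' hx' y hy z hz hxx' hyx hzx
    by_cases hne : x' = x
    · subst hne
      have key : ∀ a b : SignType, a ≠ 0 → b ≠ 0 → a * a = b * b := by decide
      exact key _ _ hyx hzx
    have hx'L : x' ∉ L := fun hx'L => hx'.2 (N.mem_closure_of_mem hx'L)
    have hxL : x ∉ L := fun hxL => hx.2 (N.mem_closure_of_mem hxL)
    rw [hs0 x hx x' hx'.1] at hxx'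
    -- This circuit lies in `L` together with `x` and `x'`. As every `s w` vanishes on `L`, only
    -- these two elements contribute to orthogonality.
    have hC := (hind x hx).fundCircuit_isCircuit hxx' (by simp [hne, hx'L])
    have hCs := N.fundCircuit_subset_insert x' (insert x L)
    obtain ⟨X, hX, hXC⟩ := h.exists_circuit _ hC
    have hoff : ∀ w ∈ V, ∀ g, g ≠ x → g ≠ x' → X g * s w g = 0 := by
      intro w hw g hgx hgx'
      by_cases hgE : g ∈ N.E
      · by_cases hXg : X g = 0
        · rw [hXg, zero_mul]
        · rcases hCs (hXC.subset ⟨hXg, hgE⟩) with h' | h' | h'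
          · exact absurd h' hgx'
          · exact absurd h' hgx
          · rw [hsL w hw g h', mul_zero]
      · exact h.mul_eq_zero X hX _ (hs w hw).1 g hgE
    have hXx : X x ≠ 0 := by
      have : x ∈ N.fundCircuit x' (insert x L) := by
        by_contra h0
        refine hC.not_indep ((hind x' hx').subset fun g hg => ?_)
        rcases hCs hg with h' | h' | h'
        · exact Or.inl h'
        · exact absurd (h' ▸ hg) h0
        · exact Or.inr h'
      rw [← hXC] at this
      exact this.1
    have horth : ∀ w ∈ V, s w x ≠ 0 → X x * s w x = -(X x' * s w x') := fun w hw hwx => by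
      have key : ∀ a b : SignType, a ≠ 0 → b ≠ 0 → a * b ≠ 0 := by decide
      exact (h.orthogonal X hX _ (hs w hw).1).eq_neg_of_inter (key _ _ hXx hwx) (hoff w hw)
    have h1 := horth y hy hyx
    have h2 := horth z hz hzx
    have key : ∀ p q a b : SignType, p ≠ 0 → a ≠ 0 → p * a = -(q * b) → a * b = -(p * q) := by
      decide
    rw [key _ _ _ _ hXx hyx h1, key _ _ _ _ hXx hzx h2]
  · intro x hx y hy z hz hxy hyz hxz
    rw [Ne, hs0 x hx y hy.1] at hxy
    rw [Ne, hs0 y hy z hz.1] at hyz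
    rw [Ne, hs0 x hx z hz.1] at hxz
    have hyx : x ∉ N.closure (insert y L) := fun h' => hxy (hsymm y hy x hx h')
    have hzy : y ∉ N.closure (insert z L) := fun h' => hyz (hsymm z hz y hy h')
    have hzx : x ∉ N.closure (insert z L) := fun h' => hxz (hsymm z hz x hx h')
    have hbx := hbase x hx y hy hxy
    have hnxy : x ≠ y := by rintro rfl; exact hxy (hself _ hx)
    have hnyz : y ≠ z := by rintro rfl; exact hyz (hself _ hy)
    have hnxz : x ≠ z := by rintro rfl; exact hxz (hself _ hx)
    have hzL : z ∉ L := fun hzL => hz.2 (N.mem_closure_of_mem hzL)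
    have hC := hbx.fundCircuit_isCircuit hz.1 (by simp [hnyz.symm, hnxz.symm, hzL])
    have hCs := N.fundCircuit_subset_insert z (insert y (insert x L))
    obtain ⟨X, hX, hXC⟩ := h.exists_circuit _ hC
    have hsub : ∀ g, X g ≠ 0 → g ∈ N.E → g = z ∨ g = y ∨ g = x ∨ g ∈ L := fun g hg hgE =>
      hCs (hXC.subset ⟨hg, hgE⟩)
    have hnind : ∀ I, N.Indep I → ¬ Function.support X ∩ N.E ⊆ I := fun I hI hsub =>
      hC.not_indep (hI.subset (hXC ▸ hsub))
    have hXx : X x ≠ 0 := fun h0 => hnind _ (hbase y hy z hz hyz).indep fun g hg => by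
      rcases hsub g hg.1 hg.2 with h' | h' | h' | h'
      · exact Or.inl h'
      · exact Or.inr (Or.inl h')
      · exact absurd (h' ▸ h0) hg.1
      · exact Or.inr (Or.inr h')
    have hXy : X y ≠ 0 := fun h0 => hnind _ (hbase x hx z hz hxz).indep fun g hg => by
      rcases hsub g hg.1 hg.2 with h' | h' | h' | h'
      · exact Or.inl h'
      · exact absurd (h' ▸ h0) hg.1
      · exact Or.inr (Or.inl h')
      · exact Or.inr (Or.inr h')
    have hXz : X z ≠ 0 := fun h0 => hnind _ hbx.indep fun g hg =>
      (hsub g hg.1 hg.2).resolve_left fun h' => hg.1 (h' ▸ h0)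
    have hoff : ∀ w ∈ V, ∀ g, g ≠ x → g ≠ y → g ≠ z → X g * s w g = 0 := by
      intro w hw g hgx hgy hgz
      by_cases hgE : g ∈ N.E
      · by_cases hXg : X g = 0
        · rw [hXg, zero_mul]
        · rcases hsub g hXg hgE with h' | h' | h' | h'
          · exact absurd h' hgz
          · exact absurd h' hgy
          · exact absurd h' hgx
          · rw [hsL w hw g h', mul_zero]
      · exact h.mul_eq_zero X hX _ (hs w hw).1 g hgE
    have hz0 : ∀ w ∈ V, X w * s w w = 0 := fun w hw => by
      rw [(hs0 w hw w hw.1).2 (hself w hw), mul_zero]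
    have key : ∀ a b : SignType, a ≠ 0 → b ≠ 0 → a * b ≠ 0 := by decide
    refine ⟨X x, X y, X z, hXx, hXy, hXz, ?_, ?_, ?_, ?_⟩
    · refine (h.orthogonal X hX _ (hs x hx).1).eq_neg_of_inter
        (key _ _ hXy (by rwa [Ne, hs0 x hx y hy.1])) fun g hgy hgz => ?_
      by_cases hgx : g = x
      · rw [hgx]; exact hz0 x hx
      · exact hoff x hx g hgx hgy hgz
    · refine (h.orthogonal X hX _ (hs y hy).1).eq_neg_of_inter
        (key _ _ hXx (by rwa [Ne, hs0 y hy x hx.1])) fun g hgx hgz => ?_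
      by_cases hgy : g = y
      · rw [hgy]; exact hz0 y hy
      · exact hoff y hy g hgx hgy hgz
    · refine (h.orthogonal X hX _ (hs z hz).1).eq_neg_of_inter
        (key _ _ hXx (by rwa [Ne, hs0 z hz x hx.1])) fun g hgx hgy => ?_
      by_cases hgz : g = z
      · rw [hgz]; exact hz0 z hz
      · exact hoff z hz g hgx hgy hgz
    · rintro w hw hwx hwy hwz ⟨h1, h2⟩
      -- All nonzero products would share one sign, which orthogonality forbids.
      have hall : ∀ g, X g * s w g = 0 ∨ X g * s w g = X x * s w x := by
        intro g
        by_cases hgx : g = x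
        · right; rw [hgx]
        by_cases hgy : g = y
        · right; rw [hgy, h1]
        by_cases hgz : g = z
        · right; rw [hgz, h1, h2]
        exact Or.inl (hoff w hw g hgx hgy hgz)
      rcases h.orthogonal X hX _ (hs w hw).1 with h' | ⟨⟨p, hp⟩, q, hq⟩
      · exact key _ _ hXx hwx (h' x)
      · have hp' := hall p
        have hq' := hall q
        rw [hp] at hp'
        rw [hq] at hq'
        have key' : ∀ a : SignType, ¬ (((1 : SignType) = 0 ∨ 1 = a) ∧ (-1 = (0 : SignType) ∨ -1 = a)) := by
          decide
        exact key' _ ⟨hp', hq'⟩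

/-- In the rank two family obtained from a base through `e` and `f`, both clones are alone in their
parallel classes, so the combination supported on `e` and the class of `f` involves nothing else. -/
theorem exists_mem_signLattice_of_areClones (h : IsDualPair N 𝒳 𝒴) {e f : α}
    (hcl : AreClones N e f) (hind : N.Indep {e, f}) :
    ∃ x ∈ signLattice 𝒴, |x e| = 1 ∧ |x f| = 1 ∧ ∀ g ∈ N.E, g ≠ e → g ≠ f → x g = 0 := by
  have hef := hcl.2.2.1
  obtain ⟨B, hB, hBs⟩ := hind.exists_isBase_superset
  have heB : e ∈ B := hBs (by simp)
  have hfB : f ∈ B := hBs (by simp)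
  obtain ⟨L, hLd⟩ : ∃ L, L = B \ {e, f} := ⟨_, rfl⟩
  have heL : e ∉ L := by simp [hLd]
  have hfL : f ∉ L := by simp [hLd]
  have hBL : insert e (insert f L) = B := by
    ext g
    simp only [hLd, Set.mem_insert_iff, Set.mem_sdiff, Set.mem_singleton_iff]
    by_cases h1 : g = e
    · simp [h1, heB]
    · by_cases h2 : g = f
      · simp [h2, hfB]
      · simp [h1, h2]
  rw [← hBL] at hB
  obtain ⟨s, hs, hs0, hfam⟩ := h.exists_isRankTwoFamily heL hfL hef hB
  have hi1 : N.Indep (insert f L) := hB.indep.subset (Set.subset_insert _ _)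
  have hi2 : N.Indep (insert e L) := hB.indep.subset
    (Set.insert_subset_insert (Set.subset_insert _ _))
  have hi : N.Indep L := hi1.subset (Set.subset_insert _ _)
  have heV : e ∈ N.E \ N.closure L := (hi.insert_indep_iff.1 hi2).resolve_right heL
  have hfV : f ∈ N.E \ N.closure L := (hi.insert_indep_iff.1 hi1).resolve_right hfL
  have hfe : f ∉ N.closure (insert e L) := by
    have hB' := hB.indep
    rw [Set.insert_comm] at hB'
    exact ((hi2.insert_indep_iff.1 hB').resolve_right (by simp [hef.symm, hfL])).2
  have hpe := fun g => hcl.eq_of_mem_closure_insert (g := g) heL hfL hB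
  have hpf := fun g => hcl.symm.eq_of_mem_closure_insert (g := g) hfL heL
    (by rwa [Set.insert_comm])
  obtain ⟨x, hx, hxe, σ, hσ, hxg⟩ := hfam.exists_mem_signLattice heV
    (fun g hg h0 => hpe g hg ((hs0 e heV g hg.1).1 h0)) hfV hef.symm
  refine ⟨x, signLattice_mono (by rintro _ ⟨y, hy, rfl⟩; exact hs y hy) hx, by simp [hxe], ?_,
    fun g hg hge hgf => ?_⟩
  · rw [hxg f hfV hef.symm, if_pos (hfam.refl f hfV), abs_mul, hσ, one_mul]
    have h0 : s e f ≠ 0 := by rwa [Ne, hs0 e heV f hfV.1]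
    have key : ∀ a : SignType, a ≠ 0 → |(a : ℤ)| = 1 := by decide
    exact key _ h0
  · by_cases hgV : g ∈ N.closure L
    · refine signLattice_apply_eq_zero ?_ hx
      rintro _ ⟨y, hy, rfl⟩
      exact (hs0 y hy g hg).2 (N.closure_subset_closure (Set.subset_insert _ _) hgV)
    · rw [hxg g ⟨hg, hgV⟩ hge, if_neg]
      rw [hs0 f hfV g hg]
      exact fun h' => hgf (hpf g ⟨hg, hgV⟩ h')

end IsDualPair

end DualPair

/-! ### Nowhere-zero coflows and generalized series parallel oriented matroids -/

section Coflows

open scoped Matroid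

variable {α : Type*} {M N : Matroid α} {𝒳 𝒴 : Set (SignVec α)}

lemma Matroid.IsCircuit.eq_pair_of_subset (hN : N.Loopless) {C : Set α} (hC : N.IsCircuit C)
    {a b : α} (h : C ⊆ {a, b}) : C = {a, b} := by
  obtain ⟨x, hx, y, hy, hxy⟩ := Matroid.loopless_iff_forall_isCircuit.1 hN C hC
  refine h.antisymm ?_
  rcases h hx with rfl | rfl <;> rcases h hy with rfl | rfl
  · exact absurd rfl hxy
  · exact Set.insert_subset hx (Set.singleton_subset_iff.2 hy)
  · exact Set.insert_subset hy (Set.singleton_subset_iff.2 hx)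
  · exact absurd rfl hxy

lemma Matroid.Loopless.not_isLoopPlusColoop (hN : N.Loopless) : ¬ IsLoopPlusColoop N :=
  fun ⟨e, _, _, he, _⟩ => N.not_isLoop e he

lemma IsDualPair.exists_ne_zero (h : IsDualPair N 𝒳 𝒴) {e : α} (he : N.IsNonloop e) :
    ∃ Y ∈ 𝒴, Y e ≠ 0 := by
  obtain ⟨D, hD, heD⟩ := he.exists_mem_isCocircuit
  obtain ⟨Y, hY, hYD⟩ := h.exists_cocircuit D hD
  rw [← hYD] at heD
  exact ⟨Y, hY, heD.1⟩

lemma IsDualPair.abs_eq_of_isCircuit_pair (h : IsDualPair N 𝒳 𝒴) {e f : α}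
    (hC : N.IsCircuit {e, f}) {x : α → ℤ} (hx : x ∈ signLattice 𝒴) : |x f| = |x e| := by
  obtain ⟨X, hX, hXC⟩ := h.exists_circuit _ hC
  have hXe : X e ≠ 0 := (hXC.symm.subset (show e ∈ ({e, f} : Set α) by simp)).1
  have hXf : X f ≠ 0 := (hXC.symm.subset (show f ∈ ({e, f} : Set α) by simp)).1
  have hoff : ∀ Y ∈ 𝒴, ∀ g, g ≠ e → g ≠ f → X g * Y g = 0 := by
    intro Y hY g hge hgf
    by_cases hgE : g ∈ N.E
    · by_cases hXg : X g = 0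
      · rw [hXg, zero_mul]
      · rcases hXC.subset ⟨hXg, hgE⟩ with h' | h'
        exacts [absurd h' hge, absurd h' hgf]
    · exact h.mul_eq_zero X hX Y hY g hgE
  have habs : ∀ a b : SignType, a ≠ 0 → b ≠ 0 → |(-((a : ℤ) * b))| = 1 := by decide
  refine signLattice_abs_eq (habs _ _ hXe hXf) (fun Y hY => ?_) hx
  have hmul : ∀ a b : SignType, a ≠ 0 → b ≠ 0 → a * b ≠ 0 := by decide
  by_cases hYe : Y e = 0
  · have hYf : Y f = 0 := by
      by_contra h0
      have := (h.orthogonal X hX Y hY).eq_neg_of_inter (hmul _ _ hXf h0)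
        (fun g hgf hge => hoff Y hY g hge hgf)
      rw [hYe, mul_zero, neg_zero] at this
      exact hmul _ _ hXf h0 this
    simp [hYe, hYf]
  · have := (h.orthogonal X hX Y hY).eq_neg_of_inter (hmul _ _ hXe hYe) (hoff Y hY)
    have key : ∀ a b c d : SignType, a ≠ 0 → b ≠ 0 → a * c = -(b * d) →
        (d : ℤ) = -((a : ℤ) * b) * c := by decide
    exact key _ _ _ _ hXe hXf this

/-- Height bounded matroids without loops have nowhere-zero `3`-coflows. -/
theorem IsDualPair.exists_nowhereZero (hN : IsHeightBounded N) (hl : N.Loopless)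
    (h : IsDualPair N 𝒳 𝒴) : ∃ x ∈ signLattice 𝒴, ∀ e ∈ N.E, 0 < |x e| ∧ |x e| < 3 := by
  induction hn : N.E.ncard using Nat.strong_induction_on generalizing N 𝒳 𝒴 with
  | _ n ih =>
  subst hn
  have hlt : ∀ e ∈ N.E, (N.E \ {e}).ncard < N.E.ncard := fun e he =>
    Set.ncard_sdiff_singleton_lt_of_mem he h.finite
  by_cases hpar : ∃ e f, e ≠ f ∧ N.IsCircuit {e, f}
  · obtain ⟨e, f, hef, hC⟩ := hpar
    have heE : e ∈ N.E := hC.subset_ground (by simp)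
    have hfE : f ∈ N.E := hC.subset_ground (by simp)
    obtain ⟨x, hx, hx0⟩ := ih _ (hlt f hfE) (hN.delete {f})
      ((N.delete_isRestriction {f}).loopless) (h.delete (Set.singleton_subset_iff.2 hfE)) rfl
    refine ⟨x, hx, fun g hg => ?_⟩
    by_cases hgf : g = f
    · rw [hgf, h.abs_eq_of_isCircuit_pair hC hx]
      exact hx0 e ⟨heE, hef⟩
    · exact hx0 g ⟨hg, hgf⟩
  push Not at hpar
  by_cases hnt : N.E.Nontrivial
  · obtain ⟨e, f, hcl⟩ := hN.exists_areClones hnt hl.not_isLoopPlusColoop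
    have hef := hcl.2.2.1
    have hind : N.Indep {e, f} := by
      rw [Matroid.indep_iff_forall_subset_not_isCircuit (Set.pair_subset hcl.1 hcl.2.1)]
      intro C hCs hC
      exact hpar e f hef (hC.eq_pair_of_subset hl hCs ▸ hC)
    obtain ⟨y, hy, hye, hyf, hy0⟩ := h.exists_mem_signLattice_of_areClones hcl hind
    -- A loop of the contraction would be parallel to `e`, and there are no parallel pairs left.
    have hl' : (N ／ {e}).Loopless := by
      rw [Matroid.loopless_iff_forall_not_isLoop]
      intro g _ hgl
      obtain ⟨hg, hge⟩ := Matroid.contract_isLoop_iff_mem_closure.1 hgl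
      obtain ⟨C, hCs, hC, -⟩ := Matroid.exists_isCircuit_of_mem_closure hg hge
      exact hpar g e hge (hC.eq_pair_of_subset hl hCs ▸ hC)
    obtain ⟨x, hx, hx0⟩ := ih _ (hlt e hcl.1) (hN.contract {e}) hl'
      (h.contract (Set.singleton_subset_iff.2 hcl.1)) rfl
    have hxe : x e = 0 := signLattice_apply_eq_zero (fun Y hY => hY.2 e rfl) hx
    have hxf := hx0 f ⟨hcl.2.1, hef.symm⟩
    replace hx : x ∈ signLattice 𝒴 := signLattice_mono (fun Y hY => hY.1) hx
    -- The sign `t` is chosen to turn absolute value `1` into `2` and `2` into `1`, without crossing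
    -- zero.
    obtain ⟨t, ht, htf⟩ : ∃ t : ℤ, |t| = 1 ∧ 0 < |x f + t * y f| ∧ |x f + t * y f| < 3 := by
      obtain ⟨h1, h2⟩ := hxf
      rw [abs_lt] at h2
      have hx' : x f = -2 ∨ x f = -1 ∨ x f = 1 ∨ x f = 2 := by
        have := abs_pos.1 h1
        omega
      rcases abs_eq (zero_le_one (α := ℤ)) |>.1 hyf with hy' | hy' <;>
        rcases hx' with hx' | hx' | hx' | hx' <;> rw [hx', hy']
      exacts [⟨1, by decide⟩, ⟨-1, by decide⟩, ⟨1, by decide⟩, ⟨-1, by decide⟩,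
        ⟨-1, by decide⟩, ⟨1, by decide⟩, ⟨-1, by decide⟩, ⟨1, by decide⟩]
    refine ⟨x + t • y, add_mem hx (AddSubgroup.zsmul_mem _ hy t), fun g hg => ?_⟩
    simp only [Pi.add_apply, Pi.smul_apply, smul_eq_mul]
    by_cases hge : g = e
    · rw [hge, hxe, zero_add, abs_mul, ht, hye]
      norm_num
    · by_cases hgf : g = f
      · rw [hgf]; exact htf
      · rw [hy0 g hg hge hgf, mul_zero, add_zero]
        exact hx0 g ⟨hg, hge⟩
  · rw [Set.not_nontrivial_iff] at hnt
    rcases hnt.eq_empty_or_singleton with hE | ⟨e, hE⟩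
    · exact ⟨0, zero_mem _, by simp [hE]⟩
    · obtain ⟨Y, hY, hYe⟩ := h.exists_ne_zero
        (Matroid.loopless_iff_forall_isNonloop.1 hl e (hE ▸ rfl))
      refine ⟨_, coe_mem_signLattice hY, fun g hg => ?_⟩
      rw [hE, Set.mem_singleton_iff] at hg
      subst hg
      have key : ∀ a : SignType, a ≠ 0 → 0 < |(a : ℤ)| ∧ |(a : ℤ)| < 3 := by decide
      exact key _ hYe

/-! ### From orientations and their minors to dual pairs -/

/-- A nonzero sign vector that is orthogonal to signatures of all circuits is not supported
properly inside a cocircuit. -/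
lemma Matroid.IsCocircuit.eq_support_of_subset {D : Set α} (hD : N.IsCocircuit D)
    (h𝒳 : ∀ C, N.IsCircuit C → ∃ X ∈ 𝒳, Function.support X = C) {Z : SignVec α} (hZ : Z ≠ 0)
    (horth : ∀ X ∈ 𝒳, SignOrthogonal X Z) (hsub : Function.support Z ⊆ D) :
    Function.support Z = D := by
  by_contra hne
  have hco : N.Coindep (Function.support Z) := hD.isCircuit.ssubset_indep (hsub.ssubset_of_ne hne)
  obtain ⟨B, hB, hBs⟩ := hco.exists_isBase_subset_compl
  obtain ⟨e, he⟩ := Function.support_nonempty_iff.2 hZ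
  have heB : e ∉ B := fun heB => (hBs heB).2 he
  have hC := hB.fundCircuit_isCircuit (hco.subset_ground he) heB
  obtain ⟨X, hX, hXC⟩ := h𝒳 _ hC
  have hXe : X e ≠ 0 := by
    rw [← Function.mem_support, hXC]
    exact N.mem_fundCircuit e B
  have hmul : ∀ a b : SignType, a ≠ 0 → b ≠ 0 → a * b ≠ 0 := by decide
  have hoff : ∀ g, g ≠ e → X g * Z g = 0 := by
    intro g hge
    by_cases hXg : X g = 0
    · rw [hXg, zero_mul]
    · have hgB : g ∈ B := ((hXC ▸ N.fundCircuit_subset_insert e B :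
        Function.support X ⊆ insert e B) hXg).resolve_left hge
      have : g ∉ Function.support Z := (hBs hgB).2
      rw [Function.notMem_support.1 this, mul_zero]
  -- The fundamental circuit of `e` meets the support of `Z` only in `e`, so a nonzero sign would
  -- equal its own negative.
  have := (horth X hX).eq_neg_of_inter (hmul _ _ hXe he) (fun g hge _ => hoff g hge) (f := e)
  have key : ∀ a : SignType, a ≠ 0 → a ≠ -a := by decide
  exact key _ (hmul _ _ hXe he) this

/-- A signed system whose circuit supports are the circuits of `N` and which has a signed version
of each cocircuit of `N` gives rise to a dual pair. -/
lemma SignedSystem.isDualPair {S : SignedSystem α} (hfin : N.E.Finite) (hg : S.ground = N.E)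
    (hC : ∀ C, N.IsCircuit C ↔ ∃ X ∈ S.circuits, Function.support X = C)
    (hD : ∀ D, N.IsCocircuit D → ∃ Y : SignVec α, Function.support Y = D ∧
      ∀ X ∈ S.circuits, SignOrthogonal X Y) : IsDualPair N S.circuits S.cocircuits where
  finite := hfin
  exists_circuit C hC' := by
    obtain ⟨X, hX, rfl⟩ := (hC C).1 hC'
    exact ⟨X, hX, Set.inter_eq_left.2 hC'.subset_ground⟩
  exists_cocircuit D hD' := by
    obtain ⟨Y, rfl, hY⟩ := hD D hD'
    refine ⟨Y, ⟨⟨hg ▸ hD'.subset_ground, hY⟩, ?_, fun Z hZ hZ0 hsub =>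
      hD'.eq_support_of_subset (fun C => (hC C).1) hZ0 hZ.2 hsub⟩,
      Set.inter_eq_left.2 hD'.subset_ground⟩
    exact Function.support_nonempty_iff.1 hD'.nonempty
  orthogonal X hX Y hY := hY.1.2 X hX
  mul_eq_zero X hX Y hY e he := by
    have : e ∉ Function.support Y := fun h => he (hg ▸ hY.1.1 h)
    rw [Function.notMem_support.1 this, mul_zero]

lemma SignedSystem.IsOrientationOf.isDualPair {O : SignedSystem α} (hO : O.IsOrientationOf M) :
    IsDualPair M O.circuits O.cocircuits :=
  SignedSystem.isDualPair (hO.2.1 ▸ hO.1.finite) hO.2.1 hO.2.2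
    fun _ hD => hO.exists_signOrthogonal hD

/-- The circuits of `M ／ A` are the minimal nonempty sets `C \ A` with `C` a circuit of `M`, so only
supports matter and no signed axiom is used. -/
lemma SignedSystem.IsOrientationOf.contract_isCircuit_iff {O : SignedSystem α}
    (hO : O.IsOrientationOf M) (A C : Set α) :
    (M ／ A).IsCircuit C ↔ ∃ X ∈ (O.contract A).circuits, Function.support X = C := by
  have hsupp : ∀ X : SignVec α, Function.support (Set.indicator Aᶜ X) = Function.support X \ A :=
    fun X => by rw [Set.support_indicator, Set.inter_comm, Set.sdiff_eq]
  have hlift : ∀ C, (M ／ A).IsCircuit C → ∃ X ∈ O.circuits, Function.support X \ A = C := by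
    intro C hC
    obtain ⟨C', hC', h1, h2⟩ := hC.exists_subset_isCircuit_of_contract
    obtain ⟨X, hX, rfl⟩ := (hO.2.2 C').1 hC'
    refine ⟨X, hX, Set.Subset.antisymm (fun g hg => (h2 hg.1).resolve_right hg.2)
      fun g hg => ⟨h1 hg, (hC.subset_ground hg).2⟩⟩
  have hdep : ∀ X ∈ O.circuits, Set.indicator Aᶜ X ≠ 0 → (M ／ A).Dep (Function.support X \ A) := by
    intro X hX hne
    refine (hO.isCircuit_support hX).contract_dep_of_not_subset fun hsub => hne ?_
    rw [← Function.support_eq_empty_iff, hsupp, Set.sdiff_eq_empty]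
    exact hsub
  constructor
  · intro hC
    obtain ⟨X, hX, hXC⟩ := hlift C hC
    refine ⟨Set.indicator Aᶜ X, ⟨⟨X, hX, rfl⟩, ?_, ?_⟩, by rw [hsupp, hXC]⟩
    · rw [← Function.support_nonempty_iff, hsupp, hXC]
      exact hC.nonempty
    · rintro _ ⟨Z, hZ, rfl⟩ hne hsub
      have hd := hdep Z hZ hne
      simp only [hsupp] at hsub ⊢
      rw [hXC] at hsub ⊢
      exact hC.eq_of_dep_subset hd hsub
  · rintro ⟨_, ⟨⟨X, hX, rfl⟩, hne, hmin⟩, rfl⟩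
    have hd := hdep X hX hne
    obtain ⟨C, hCs, hC⟩ := hd.exists_isCircuit_subset
    obtain ⟨Z, hZ, hZC⟩ := hlift C hC
    have hmin' := hmin _ ⟨Z, hZ, rfl⟩ (by
      simp only [ne_eq]
      rw [← ne_eq, ← Function.support_nonempty_iff, hsupp, hZC]
      exact hC.nonempty)
    simp only [hsupp, hZC] at hmin' ⊢
    rw [← hmin' hCs]
    exact hC

lemma SignedSystem.IsOrientationOf.minor_isCircuit_iff {O : SignedSystem α}
    (hO : O.IsOrientationOf M) (A B C : Set α) : (M ／ A ＼ B).IsCircuit C ↔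
      ∃ X ∈ ((O.contract A).delete B).circuits, Function.support X = C := by
  rw [Matroid.delete_isCircuit_iff, hO.contract_isCircuit_iff]
  constructor
  · rintro ⟨⟨X, hX, rfl⟩, hdj⟩
    exact ⟨X, ⟨hX, hdj⟩, rfl⟩
  · rintro ⟨X, ⟨hX, hdj⟩, rfl⟩
    exact ⟨⟨X, hX, rfl⟩, hdj⟩

/-- A cocircuit of the minor comes from a cocircuit of `M` that avoids `A`, with its part in `B` cut
off. Circuits of the minor vanish on `B`, so the products with them are unchanged and orthogonality
is inherited from `M`. -/
lemma SignedSystem.IsOrientationOf.minor_isDualPair {O : SignedSystem α}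
    (hO : O.IsOrientationOf M) (A B : Set α) :
    IsDualPair (M ／ A ＼ B) ((O.contract A).delete B).circuits
      ((O.contract A).delete B).cocircuits := by
  have hfin : M.E.Finite := hO.2.1 ▸ hO.1.finite
  refine SignedSystem.isDualPair ((hfin.subset Set.sdiff_subset).subset Set.sdiff_subset) ?_ ?_ ?_
  · change (O.ground \ A) \ B = (M.E \ A) \ B
    rw [hO.2.1]
  · exact hO.minor_isCircuit_iff A B
  · intro D hD
    have hDB : Disjoint D B := (Set.subset_sdiff.1 hD.subset_ground).2
    have hD2 := hD.isCircuit
    rw [Matroid.dual_contract_delete] at hD2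
    obtain ⟨D', hD', h1, h2⟩ := hD2.exists_subset_isCircuit_of_contract
    obtain ⟨hD'M, hD'A⟩ := Matroid.delete_isCircuit_iff.1 hD'
    obtain ⟨Y, rfl, hY⟩ := hO.exists_signOrthogonal hD'M
    refine ⟨Set.indicator Bᶜ Y, ?_, ?_⟩
    · rw [Set.support_indicator]
      ext g
      refine ⟨fun hg => (h2 hg.2).resolve_right hg.1, fun hg => ⟨?_, h1 hg⟩⟩
      exact Set.disjoint_left.1 hDB hg
    · rintro _ ⟨⟨⟨X, hX, rfl⟩, -⟩, hdj⟩
      have hprod : ∀ g, Set.indicator Aᶜ X g * Set.indicator Bᶜ Y g = X g * Y g := by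
        intro g
        by_cases hgA : g ∈ A
        · have : g ∉ Function.support Y := Set.disjoint_right.1 hD'A hgA
          have hYg : Y g = 0 := Function.notMem_support.1 this
          simp [hYg]
        · by_cases hgB : g ∈ B
          · have : g ∉ Function.support (Set.indicator Aᶜ X) := Set.disjoint_right.1 hdj hgB
            have hXg := Function.notMem_support.1 this
            rw [hXg, zero_mul]
            rw [Set.indicator_of_mem (by simpa using hgA)] at hXg
            rw [hXg, zero_mul]
          · rw [Set.indicator_of_mem (by simpa using hgA), Set.indicator_of_mem (by simpa using hgB)]
      have := hY X hX
      unfold SignOrthogonal at this ⊢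
      simpa only [hprod] using this

/-- Every orientation of a height bounded matroid is generalized series parallel. -/
theorem IsHeightBounded.isGSP (hM : IsHeightBounded M) {O : SignedSystem α}
    (hO : O.IsOrientationOf M) : O.IsGSP := by
  intro A B hne hsimple
  obtain ⟨S, hS⟩ : ∃ S, S = (O.contract A).delete B := ⟨_, rfl⟩
  have hdual := hO.minor_isDualPair A B
  have hcirc := hO.minor_isCircuit_iff A B
  simp only [← hS] at hdual hcirc hne hsimple ⊢
  have hminor : (M ／ A ＼ B).IsMinor M := M.contract_delete_isMinor A B
  have hground : S.ground = (M ／ A ＼ B).E := by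
    rw [hS]
    change (O.ground \ A) \ B = (M.E \ A) \ B
    rw [hO.2.1]
  obtain ⟨N, hN⟩ : ∃ N, N = M ／ A ＼ B := ⟨_, rfl⟩
  rw [← hN] at hdual hminor hground hcirc
  rw [hground] at hne
  have hbig : ∀ C, N.IsCircuit C → 3 ≤ C.encard := by
    intro C hC
    obtain ⟨X, hX, rfl⟩ := (hcirc C).1 hC
    exact hsimple X hX
  have hl : N.Loopless := by
    rw [Matroid.loopless_iff_forall_not_isLoop]
    intro e _ he
    have := hbig _ he.isCircuit
    rw [Set.encard_singleton] at this
    exact absurd this (by decide)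
  have hoff : ∀ x ∈ S.coflowLattice, ∀ g ∉ N.E, x g = 0 := by
    intro x hx g hg
    refine signLattice_apply_eq_zero (𝒴 := S.cocircuits) (fun Y hY => ?_) hx
    by_contra h0
    exact hg (hground ▸ hY.1.1 h0)
  by_cases hnt : N.E.Nontrivial
  · obtain ⟨e, f, hcl⟩ := (hM.isMinor hminor).exists_areClones hnt hl.not_isLoopPlusColoop
    have hind : N.Indep {e, f} := by
      rw [Matroid.indep_iff_forall_subset_not_isCircuit (Set.pair_subset hcl.1 hcl.2.1)]
      intro C hCs hC
      have h1 := (hbig C hC).trans ((Set.encard_le_encard hCs).trans (Set.encard_pair hcl.2.2.1).le)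
      exact absurd h1 (by decide)
    obtain ⟨x, hx, hxe, hxf, hx0⟩ := hdual.exists_mem_signLattice_of_areClones hcl hind
    have hzero : ∀ g, g ≠ e → g ≠ f → x g = 0 := fun g hge hgf => by
      by_cases hg : g ∈ N.E
      · exact hx0 g hg hge hgf
      · exact hoff x hx g hg
    refine ⟨x, hx, ?_, fun g => ?_, ?_⟩
    · rintro rfl
      simp at hxe
    · by_cases hge : g = e
      · rw [hge]
        exact Or.inr ((abs_eq zero_le_one).1 hxe)
      by_cases hgf : g = f
      · rw [hgf]
        exact Or.inr ((abs_eq zero_le_one).1 hxf)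
      exact Or.inl (hzero g hge hgf)
    · refine (Set.encard_le_encard (t := {e, f}) fun g hg => ?_).trans (Set.encard_pair hcl.2.2.1).le
      by_contra hcon
      simp only [Set.mem_insert_iff, Set.mem_singleton_iff, not_or] at hcon
      exact hg (hzero g hcon.1 hcon.2)
  · rw [Set.not_nontrivial_iff] at hnt
    obtain ⟨e, he⟩ := hne
    obtain ⟨Y, hY, hYe⟩ := hdual.exists_ne_zero (Matroid.loopless_iff_forall_isNonloop.1 hl e he)
    have hmem : (fun g => (Y g : ℤ)) ∈ S.coflowLattice := coe_mem_signLattice hY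
    refine ⟨_, hmem, ?_, fun g => ?_, ?_⟩
    · intro h0
      have key : ∀ a : SignType, a ≠ 0 → (a : ℤ) ≠ 0 := by decide
      exact key _ hYe (congrFun h0 e)
    · have key : ∀ a : SignType, (a : ℤ) = 0 ∨ (a : ℤ) = 1 ∨ (a : ℤ) = -1 := by decide
      exact key _
    · refine (Set.encard_le_encard (t := {e}) fun g hg => ?_).trans ?_
      · by_contra hge
        refine hg (hoff _ hmem g fun hgE => hge (hnt hgE he))
      · rw [Set.encard_singleton]
        decide

end Coflows

theorem mainTheorem6 {α : Type*} (M : Matroid α) (hM : IsLatticePathMatroid M) :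
    (∀ O : SignedSystem α, O.IsOrientationOf M → O.IsGSP) ∧
    (M.Loopless → ∀ O : SignedSystem α, O.IsOrientationOf M → O.HasNowhereZeroCoflow 3) ∧
    (M.E.Nontrivial → ¬ IsLoopPlusColoop M → ∃ e f, AreClones M e f) ∧
    IsCloneReducible M := by
  have h := hM.isHeightBounded
  refine ⟨fun O hO => h.isGSP hO, fun hl O hO => ?_, h.exists_areClones, h.isCloneReducible⟩
  obtain ⟨x, hx, hx0⟩ := hO.isDualPair.exists_nowhereZero h hl
  exact ⟨x, hx, fun e he => hx0 e (hO.2.1 ▸ he)⟩
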